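/- Let $\mathsf k$ be a field, $n\ge 0$, and $S=\mathsf k[x_1,\dots,x_n]$ with the standard grading $\deg x_i=1$. A monomial ideal $I\subseteq S$ (an ideal generated by monomials) is called stable if for every nonconstant monomial $u\in I$, with $m(u)$ the largest index $t$ such that $x_t\mid u$, and for every $i<m(u)$, one has $x_i\,(u/x_{m(u)})\in I$. The integral closure $\bar I$ of an ideal $I$ is the ideal of all $x\in S$ satisfying an equation $x^d+a_1x^{d-1}+\cdots+a_d=0$ with $d\ge 1$ and $a_i\in I^i$ for $1\le i\le d$. For a nonzero finitely generated graded $S$-module $M$ put $$\operatorname{reg}(M)=\max\{\,j-i \mid \beta_{i,j}(M)\neq 0\,\},\qquad \beta_{i,j}(M)=\dim_{\mathsf k}\operatorname{Tor}_i^S(M,\mathsf k)_j ,$$ where the graded pieces of $\operatorname{Tor}$ are computed from any graded free resolution of $M$. Theorem. Let $I\subseteq S$ be a nonzero stable monomial ideal. Then the maxima defining $\operatorname{reg}(I)$ and $\operatorname{reg}(\bar I)$ exist, and $$\operatorname{reg}(\bar I)\le\operatorname{reg}(I).$$ -/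

import Mathlib

open MvPolynomial

universe u

set_option maxSynthPendingDepth 3

namespace StableReg

section IntegralClosure

variable {R : Type*} [CommRing R]

/-- `x` is integral over the ideal `I`: there are `d ≥ 1` and `a₁ ∈ I, …, a_d ∈ I ^ d` with
`x ^ d + a₁ x ^ (d - 1) + ⋯ + a_d = 0`. -/
def IsIntegralOver (I : Ideal R) (x : R) : Prop :=
  ∃ d : ℕ, 1 ≤ d ∧ ∃ a : ℕ → R, (∀ i ∈ Finset.Icc 1 d, a i ∈ I ^ i) ∧
    x ^ d + ∑ i ∈ Finset.Icc 1 d, a i * x ^ (d - i) = 0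

/-- `x` is integral over `I` iff `xT` is integral over the Rees algebra `R[IT] ⊆ R[T]`. -/
theorem isIntegralOver_iff (I : Ideal R) (x : R) :
    IsIntegralOver I x ↔ IsIntegral (reesAlgebra I) (Polynomial.monomial 1 x) := by
  rcases subsingleton_or_nontrivial R with hR | hR
  · refine ⟨fun _ => ?_, fun _ => ?_⟩
    · rw [Subsingleton.elim (Polynomial.monomial 1 x) 0]
      exact isIntegral_zero
    · exact ⟨1, le_rfl, 0, fun i _ => by simp, Subsingleton.elim _ _⟩
  constructor
  · rintro ⟨d, hd, a, ha, h⟩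
    let c : ℕ → reesAlgebra I := fun i =>
      if hi : i ∈ Finset.Icc 1 d then
        ⟨Polynomial.monomial i (a i), reesAlgebra.monomial_mem.2 (ha i hi)⟩
      else 0
    have hlt : (∑ i ∈ Finset.Icc 1 d,
        Polynomial.C (c i) * Polynomial.X ^ (d - i)).degree < (d : WithBot ℕ) := by
      refine lt_of_le_of_lt (Polynomial.degree_sum_le _ _) ?_
      refine (Finset.sup_lt_iff (WithBot.bot_lt_coe d)).2 fun i hi => ?_
      refine lt_of_le_of_lt (Polynomial.degree_C_mul_X_pow_le _ _) ?_
      have := Finset.mem_Icc.1 hi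
      exact WithBot.coe_lt_coe.2 (by omega : d - i < d)
    refine ⟨Polynomial.X ^ d + ∑ i ∈ Finset.Icc 1 d,
      Polynomial.C (c i) * Polynomial.X ^ (d - i), Polynomial.monic_X_pow_add hlt, ?_⟩
    rw [Polynomial.eval₂_add, Polynomial.eval₂_finsetSum]
    have key : ∀ i ∈ Finset.Icc 1 d,
        Polynomial.eval₂ (algebraMap (reesAlgebra I) (Polynomial R)) (Polynomial.monomial 1 x)
          (Polynomial.C (c i) * Polynomial.X ^ (d - i)) =
        Polynomial.monomial d (a i * x ^ (d - i)) := by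
      intro i hi
      have hc : algebraMap (reesAlgebra I) (Polynomial R) (c i) =
          Polynomial.monomial i (a i) := by
        simp only [c, dif_pos hi]
        rfl
      rw [Polynomial.eval₂_mul, Polynomial.eval₂_C, Polynomial.eval₂_X_pow, hc,
        Polynomial.monomial_pow, Polynomial.monomial_mul_monomial]
      have := Finset.mem_Icc.1 hi
      rw [one_mul, Nat.add_sub_cancel' this.2]
    rw [Finset.sum_congr rfl key, ← map_sum, Polynomial.eval₂_X_pow, Polynomial.monomial_pow,
      one_mul, ← map_add, h, map_zero]
  · rintro ⟨p, hp, h⟩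
    have hd : 1 ≤ p.natDegree := by
      rw [Nat.one_le_iff_ne_zero]
      intro h0
      rw [hp.natDegree_eq_zero.1 h0] at h
      simp at h
    refine ⟨p.natDegree, hd, fun i => (p.coeff (p.natDegree - i) : Polynomial R).coeff i,
      fun i _ => (mem_reesAlgebra_iff I _).1 (p.coeff (p.natDegree - i)).2 i, ?_⟩
    have h' := congrArg (fun q => Polynomial.coeff q p.natDegree) h
    simp only [Polynomial.eval₂_eq_sum_range, Polynomial.finsetSum_coeff,
      Polynomial.coeff_zero] at h'
    rw [Finset.sum_range_succ] at h'
    have top : (algebraMap (reesAlgebra I) (Polynomial R) (p.coeff p.natDegree) *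
        Polynomial.monomial 1 x ^ p.natDegree).coeff p.natDegree = x ^ p.natDegree := by
      rw [hp.coeff_natDegree, map_one, one_mul, Polynomial.monomial_pow, one_mul,
        Polynomial.coeff_monomial, if_pos rfl]
    rw [top, add_comm] at h'
    rw [← h']
    congr 1
    refine Finset.sum_nbij' (fun i => p.natDegree - i) (fun i => p.natDegree - i) ?_ ?_ ?_ ?_ ?_
    · intro i hi
      have := Finset.mem_Icc.1 hi
      exact Finset.mem_range.2 (by omega)
    · intro i hi
      have := Finset.mem_range.1 hi
      exact Finset.mem_Icc.2 (by omega)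
    · intro i hi
      have := Finset.mem_Icc.1 hi
      omega
    · intro i hi
      have := Finset.mem_range.1 hi
      omega
    · intro i hi
      have hi := Finset.mem_Icc.1 hi
      rw [Polynomial.monomial_pow, one_mul]
      have e : p.natDegree = i + (p.natDegree - i) := by omega
      conv_rhs => rw [← Polynomial.C_mul_X_pow_eq_monomial, ← mul_assoc]
      conv_rhs => arg 2; rw [e]
      rw [Polynomial.coeff_mul_X_pow, Polynomial.coeff_mul_C]
      rfl

/-- The integral closure of the ideal `I`: the set of all elements that are integral over `I`,
which is an ideal. -/
def idealClosure (I : Ideal R) : Ideal R where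
  carrier := {x | IsIntegralOver I x}
  zero_mem' := by
    refine (isIntegralOver_iff I 0).2 ?_
    simpa using isIntegral_zero
  add_mem' := by
    intro x y hx hy
    refine (isIntegralOver_iff I _).2 ?_
    rw [map_add]
    exact ((isIntegralOver_iff I x).1 hx).add ((isIntegralOver_iff I y).1 hy)
  smul_mem' := by
    rintro c x ⟨d, hd, a, ha, h⟩
    refine ⟨d, hd, fun i => c ^ i * a i, fun i hi => Ideal.mul_mem_left _ _ (ha i hi), ?_⟩
    have key : ∀ i ∈ Finset.Icc 1 d,
        c ^ i * a i * (c • x) ^ (d - i) = c ^ d * (a i * x ^ (d - i)) := by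
      intro i hi
      have : c ^ d = c ^ i * c ^ (d - i) := by
        rw [← pow_add, Nat.add_sub_cancel' (Finset.mem_Icc.1 hi).2]
      rw [this, smul_eq_mul, mul_pow]
      ring
    rw [Finset.sum_congr rfl key, ← Finset.mul_sum, smul_eq_mul, mul_pow, ← mul_add, h, mul_zero]

end IntegralClosure

section Monomial

variable {k : Type*} [Field k] {n : ℕ}

/-- A monomial ideal: an ideal of `k[x₁, …, xₙ]` generated by a set of monomials. -/
def IsMonomialIdeal (I : Ideal (MvPolynomial (Fin n) k)) : Prop :=
  ∃ A : Set (Fin n →₀ ℕ), I = Ideal.span ((fun a => monomial a (1 : k)) '' A)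

/-- A stable ideal: a monomial ideal `I` such that, for every monomial `x ^ a ∈ I` with a largest
index `t` such that `x_t ∣ x ^ a`, and every `i < t`, the monomial `x_i (x ^ a / x_t)` is in `I`. -/
def IsStable (I : Ideal (MvPolynomial (Fin n) k)) : Prop :=
  IsMonomialIdeal I ∧
    ∀ a : Fin n →₀ ℕ, monomial a (1 : k) ∈ I →
      ∀ t : Fin n, IsGreatest {l | a l ≠ 0} t → ∀ i < t,
        monomial (a - Finsupp.single t 1 + Finsupp.single i 1) (1 : k) ∈ I

end Monomial

section Regularity

variable {k : Type u} [Field k] {n : ℕ}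

/-- `f` lies in the degree `j` part of `k[x₁, …, xₙ]` for the standard `ℤ`-grading, in which every
variable has degree one. In particular only `0` lies in a part of negative degree. -/
def InDegree (f : MvPolynomial (Fin n) k) (j : ℤ) : Prop :=
  IsWeightedHomogeneous (fun _ : Fin n => (1 : ℤ)) f j

/-- A graded free resolution `⋯ → F₁ → F₀ → M → 0` of the `ℤ`-graded `k[x₁, …, xₙ]`-module
`M = ⨁ j, ℳ j`, where `F_i` is free with a basis `(e_b)` indexed by `b : ι i`, the basis element
`e_b` is homogeneous of degree `deg i b`, and all maps are homogeneous of degree zero. -/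
structure GradedFreeResolution (k : Type u) [Field k] (n : ℕ) {M : Type u} [AddCommGroup M]
    [Module (MvPolynomial (Fin n) k) M] (ℳ : ℤ → AddSubgroup M) where
  /-- The basis of `F_i`. -/
  ι : ℕ → Type u
  /-- The degrees of the basis elements. -/
  deg : ∀ i, ι i → ℤ
  /-- The differential `F_{i + 1} → F_i`. -/
  d : ∀ i, (ι (i + 1) →₀ MvPolynomial (Fin n) k) →ₗ[MvPolynomial (Fin n) k]
    (ι i →₀ MvPolynomial (Fin n) k)
  /-- The augmentation `F₀ → M`. -/
  ε : (ι 0 →₀ MvPolynomial (Fin n) k) →ₗ[MvPolynomial (Fin n) k] M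
  d_homogeneous : ∀ i b c, InDegree (d i (Finsupp.single b 1) c) (deg (i + 1) b - deg i c)
  ε_homogeneous : ∀ b, ε (Finsupp.single b 1) ∈ ℳ (deg 0 b)
  exact_d : ∀ i, Function.Exact (d (i + 1)) (d i)
  exact_ε : Function.Exact (d 0) ε
  ε_surjective : Function.Surjective ε

namespace GradedFreeResolution

variable {M : Type u} [AddCommGroup M] [Module (MvPolynomial (Fin n) k) M]
  {ℳ : ℤ → AddSubgroup M} (F : GradedFreeResolution k n ℳ)

/-- The differential `F_{i + 1} ⊗ k → F_i ⊗ k`, where `k` is the quotient of `k[x₁, …, xₙ]` by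
`(x₁, …, xₙ)`. The space `F_i ⊗ k` has the `k`-basis `(e_b ⊗ 1)` indexed by `ι i`, and the matrix
of the differential consists of the constant terms of the entries of the matrix of `d i`. -/
noncomputable def dBar (i : ℕ) : (F.ι (i + 1) →₀ k) →ₗ[k] (F.ι i →₀ k) :=
  Finsupp.linearCombination k fun b =>
    (F.d i (Finsupp.single b 1)).mapRange constantCoeff (map_zero _)

/-- The cycles of `F ⊗ k` in homological degree `i`. -/
noncomputable def cycles : ∀ i : ℕ, Submodule k (F.ι i →₀ k)
  | 0 => ⊤
  | i + 1 => LinearMap.ker (F.dBar i)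

/-- The cycles of `F ⊗ k` in homological degree `i` and internal degree `j`. -/
noncomputable def cyclesInDegree (i : ℕ) (j : ℤ) : Submodule k (F.ι i →₀ k) :=
  F.cycles i ⊓ Finsupp.supported k k {b | F.deg i b = j}

/-- `Tor_i(M, k)_j`: the part of degree `j` of the homology of `F ⊗ k` at `F_i ⊗ k`. -/
abbrev Tor (i : ℕ) (j : ℤ) : Type u :=
  F.cyclesInDegree i j ⧸ (LinearMap.range (F.dBar i)).comap (F.cyclesInDegree i j).subtype

/-- The graded Betti number `β_{i, j}(M) = dim_k Tor_i(M, k)_j`. -/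
noncomputable def betti (i : ℕ) (j : ℤ) : Cardinal.{u} :=
  Module.rank k (F.Tor i j)

end GradedFreeResolution

/-- The `ℤ`-graded module `M = ⨁ j, ℳ j` has Castelnuovo-Mumford regularity `r`, that is,
`r = max {j - i | β_{i, j}(M) ≠ 0}`, and this maximum exists. Graded free resolutions exist and the
numbers `β_{i, j}(M)` may be computed from any of them. -/
def HasRegularity (k : Type u) [Field k] (n : ℕ) {M : Type u} [AddCommGroup M]
    [Module (MvPolynomial (Fin n) k) M] (ℳ : ℤ → AddSubgroup M) (r : ℤ) : Prop :=
  Nonempty (GradedFreeResolution k n ℳ) ∧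
    ∀ F : GradedFreeResolution k n ℳ,
      IsGreatest {m : ℤ | ∃ (i : ℕ) (j : ℤ), F.betti i j ≠ 0 ∧ m = j - i} r

/-- The part of degree `j` of a (homogeneous) ideal `I`, viewed as a graded module. -/
noncomputable def idealPart (I : Ideal (MvPolynomial (Fin n) k)) (j : ℤ) : AddSubgroup I :=
  (weightedHomogeneousSubmodule k (fun _ : Fin n => (1 : ℤ)) j).toAddSubgroup.comap
    I.subtype.toAddMonoidHom

end Regularity

end StableReg

/-! The regularity of a stable ideal is the largest degree of its minimal monomial generators. It
therefore suffices that integral closure preserves stability and does not raise the degrees in which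
the ideal is generated.

Upper bound: among the minimal generators, remove a `u` of largest degree, ties being broken by the
largest sum of the indices of its variables. The remaining generators still span a stable ideal
(`IsStableSet.erase`), and its colon by `u` is generated by the variables before the last one in `u`
(`add_mem_upset_erase_iff`). Such an ideal has a linear resolution, so a mapping cone
(`RegBound.sup_span_singleton`) and induction on the number of generators give
`regBound_of_isStableSet`. Since `RegBound` concerns one well-chosen resolution, truncated at each
length, a comparison argument (`Dominated`) carries the vanishing of Tor to an arbitrary resolution.
Lower bound: a minimal generator of largest degree is not in `(x₁, …, xₙ) I`, so it gives a nonzero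
class in Tor₀.

Closure: a monomial `x ^ a` is integral over `I` iff `x ^ (m a) ∈ I ^ m` for some `m ≥ 1`
(`idealClosure_monoIdeal`). Powers of stable ideals are stable, and `I ^ m` is generated in degrees
at most `m d` if `I` is in degrees at most `d`. Moving `m` copies of the last variable of `x ^ (m
a)` shows that the closure is stable; deleting `m` copies shows that it is generated in degrees at
most `d`. -/

namespace StableReg

/-! ### Graded modules, described by projections onto their components. -/

section GradedModules

variable {k : Type u} [Field k] {n : ℕ}

local notation "S" => MvPolynomial (Fin n) k

/-- `π` is the family of projections onto the homogeneous components of `M = ⨁ j, ℳ j`. -/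
structure IsProjection {M : Type u} [AddCommGroup M] (ℳ : ℤ → AddSubgroup M)
    (π : ℤ → M →+ M) : Prop where
  mem : ∀ j m, π j m ∈ ℳ j
  same : ∀ j, ∀ m ∈ ℳ j, π j m = m
  ne : ∀ i j, i ≠ j → ∀ m ∈ ℳ i, π j m = 0
  sum : ∀ m, ∃ s : Finset ℤ, ∑ j ∈ s, π j m = m

/-- `ℳ` makes `M` a graded module over the polynomial ring. -/
structure IsGraded (k : Type u) [Field k] (n : ℕ) {M : Type u} [AddCommGroup M]
    [Module (MvPolynomial (Fin n) k) M] (ℳ : ℤ → AddSubgroup M) : Prop where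
  smul_mem : ∀ {i j : ℤ} {f : MvPolynomial (Fin n) k} {m : M},
    InDegree f i → m ∈ ℳ j → f • m ∈ ℳ (i + j)
  exists_projection : ∃ π, IsProjection ℳ π

theorem IsProjection.of_iSup {M : Type u} [AddCommGroup M] {ℳ : ℤ → AddSubgroup M}
    {π : ℤ → M →+ M} (mem : ∀ j m, π j m ∈ ℳ j) (same : ∀ j, ∀ m ∈ ℳ j, π j m = m)
    (ne : ∀ i j, i ≠ j → ∀ m ∈ ℳ i, π j m = 0) (sup : ∀ m, m ∈ ⨆ j, ℳ j) :
    IsProjection ℳ π := by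
  refine ⟨mem, same, ne, fun m => ?_⟩
  -- Allowing every larger index set makes the claim stable under addition: the two sets can be
  -- replaced by their union.
  suffices h : ∃ s : Finset ℤ, ∀ t, s ⊆ t → ∑ j ∈ t, π j m = m by
    obtain ⟨s, hs⟩ := h
    exact ⟨s, hs s subset_rfl⟩
  refine AddSubgroup.iSup_induction ℳ
    (C := fun m => ∃ s : Finset ℤ, ∀ t, s ⊆ t → ∑ j ∈ t, π j m = m) (sup m) ?_ ?_ ?_
  · intro i x hx
    refine ⟨{i}, fun t ht => ?_⟩
    rw [Finset.sum_eq_single i (fun j _ hj => ne i j hj.symm x hx)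
      (fun h => absurd (ht (Finset.mem_singleton_self i)) h), same i x hx]
  · exact ⟨∅, fun t _ => by simp⟩
  · rintro x y ⟨s, hs⟩ ⟨s', hs'⟩
    refine ⟨s ∪ s', fun t ht => ?_⟩
    simp only [map_add, Finset.sum_add_distrib]
    rw [hs t (Finset.union_subset_left ht), hs' t (Finset.union_subset_right ht)]

variable {M N P : Type u} [AddCommGroup M] [Module (MvPolynomial (Fin n) k) M]
  [AddCommGroup N] [Module (MvPolynomial (Fin n) k) N] [AddCommGroup P]
  [Module (MvPolynomial (Fin n) k) P]
  {ℳ : ℤ → AddSubgroup M} {𝒩 : ℤ → AddSubgroup N} {𝒟 : ℤ → AddSubgroup P}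

/-- Homomorphisms that are homogeneous of degree zero. -/
def IsGradedHom (ℳ : ℤ → AddSubgroup M) (𝒩 : ℤ → AddSubgroup N) (f : M →ₗ[S] N) : Prop :=
  ∀ j, ∀ m ∈ ℳ j, f m ∈ 𝒩 j

theorem IsGradedHom.comp {g : N →ₗ[S] P} {f : M →ₗ[S] N} (hg : IsGradedHom 𝒩 𝒟 g)
    (hf : IsGradedHom ℳ 𝒩 f) : IsGradedHom ℳ 𝒟 (g ∘ₗ f) :=
  fun j m hm => hg j _ (hf j m hm)

theorem IsGradedHom.add {f g : M →ₗ[S] N} (hf : IsGradedHom ℳ 𝒩 f)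
    (hg : IsGradedHom ℳ 𝒩 g) : IsGradedHom ℳ 𝒩 (f + g) :=
  fun j m hm => add_mem (hf j m hm) (hg j m hm)

theorem IsGradedHom.sub {f g : M →ₗ[S] N} (hf : IsGradedHom ℳ 𝒩 f)
    (hg : IsGradedHom ℳ 𝒩 g) : IsGradedHom ℳ 𝒩 (f - g) :=
  fun j m hm => sub_mem (hf j m hm) (hg j m hm)

theorem isGradedHom_id : IsGradedHom ℳ ℳ (LinearMap.id : M →ₗ[S] M) :=
  fun _ _ hm => hm

theorem isGradedHom_zero : IsGradedHom ℳ 𝒩 (0 : M →ₗ[S] N) :=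
  fun _ _ _ => zero_mem _

theorem IsGradedHom.projection_apply {f : M →ₗ[S] N} (hf : IsGradedHom ℳ 𝒩 f)
    {π : ℤ → M →+ M} (hπ : IsProjection ℳ π) {ρ : ℤ → N →+ N} (hρ : IsProjection 𝒩 ρ)
    (j : ℤ) (m : M) : f (π j m) = ρ j (f m) := by
  have key : ∀ (i : ℤ) (x : M), x ∈ ℳ i → f (π j x) = ρ j (f x) := by
    intro i x hx
    rcases eq_or_ne i j with rfl | hij
    · rw [hπ.same _ _ hx, hρ.same _ _ (hf _ _ hx)]
    · rw [hπ.ne _ _ hij _ hx, hρ.ne _ _ hij _ (hf _ _ hx), map_zero]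
  obtain ⟨s, hs⟩ := hπ.sum m
  rw [← hs]
  simp only [map_sum]
  exact Finset.sum_congr rfl fun i _ => key i _ (hπ.mem i m)

/-- Graded maps commute with the projections, so the degree `j` component of any preimage is again a
preimage. -/
theorem IsGradedHom.exists_preimage {f : M →ₗ[S] N} (hf : IsGradedHom ℳ 𝒩 f)
    (hM : IsGraded k n ℳ) (hN : IsGraded k n 𝒩) {j : ℤ} {y : N} (hy : y ∈ 𝒩 j)
    (hr : y ∈ LinearMap.range f) : ∃ m ∈ ℳ j, f m = y := by
  obtain ⟨π, hπ⟩ := hM.exists_projection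
  obtain ⟨ρ, hρ⟩ := hN.exists_projection
  obtain ⟨m, rfl⟩ := hr
  exact ⟨π j m, hπ.mem j m, by rw [hf.projection_apply hπ hρ, hρ.same _ _ hy]⟩

/-- The grading induced on a submodule. -/
noncomputable def subPart (ℳ : ℤ → AddSubgroup M) (K : Submodule S M) (j : ℤ) : AddSubgroup K :=
  (ℳ j).comap K.subtype.toAddMonoidHom

theorem mem_subPart {K : Submodule S M} {j : ℤ} {x : K} : x ∈ subPart ℳ K j ↔ (x : M) ∈ ℳ j :=
  Iff.rfl

theorem isGradedHom_subtype (K : Submodule S M) : IsGradedHom (subPart ℳ K) ℳ K.subtype :=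
  fun _ _ hm => hm

theorem IsGraded.submodule (hM : IsGraded k n ℳ) {π : ℤ → M →+ M} (hπ : IsProjection ℳ π)
    (K : Submodule S M) (hK : ∀ j, ∀ x ∈ K, π j x ∈ K) : IsGraded k n (subPart ℳ K) := by
  refine ⟨fun hf hm => hM.smul_mem hf hm, fun j =>
    { toFun := fun x => ⟨π j x, hK j x x.2⟩
      map_zero' := by ext; simp
      map_add' := by intro x y; ext; simp }, ?_, ?_, ?_, ?_⟩
  · exact fun j m => hπ.mem j m
  · exact fun j m hm => Subtype.ext (hπ.same j m hm)
  · exact fun i j hij m hm => Subtype.ext (hπ.ne i j hij m hm)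
  · intro m
    obtain ⟨s, hs⟩ := hπ.sum (m : M)
    refine ⟨s, Subtype.ext ?_⟩
    rw [AddSubmonoidClass.coe_finsetSum]
    exact hs

theorem IsGraded.comap (hM : IsGraded k n ℳ) (hN : IsGraded k n 𝒩) (hP : IsGraded k n 𝒟)
    {f : M →ₗ[S] N} (hf : IsGradedHom ℳ 𝒩 f) {g : P →ₗ[S] N} (hg : IsGradedHom 𝒟 𝒩 g) :
    IsGraded k n (subPart 𝒟 ((LinearMap.range f).comap g)) := by
  obtain ⟨π, hπ⟩ := hM.exists_projection
  obtain ⟨ρ, hρ⟩ := hN.exists_projection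
  obtain ⟨σ, hσ⟩ := hP.exists_projection
  refine hP.submodule hσ _ ?_
  rintro j x ⟨y, hy⟩
  exact ⟨π j y, by rw [hf.projection_apply hπ hρ, hy, hg.projection_apply hσ hρ]⟩

theorem IsGraded.ker (hM : IsGraded k n ℳ) (hN : IsGraded k n 𝒩) {f : M →ₗ[S] N}
    (hf : IsGradedHom ℳ 𝒩 f) : IsGraded k n (subPart ℳ (LinearMap.ker f)) := by
  obtain ⟨π, hπ⟩ := hM.exists_projection
  obtain ⟨ρ, hρ⟩ := hN.exists_projection
  refine hM.submodule hπ _ fun j x hx => ?_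
  rw [LinearMap.mem_ker] at hx ⊢
  rw [hf.projection_apply hπ hρ, hx, map_zero]

/-- The degree `j` part of the free module with homogeneous basis elements of degrees `deg`. -/
def freePart {ι : Type u} (deg : ι → ℤ) (j : ℤ) : AddSubgroup (ι →₀ S) where
  carrier := {f | ∀ c, InDegree (f c) (j - deg c)}
  zero_mem' _ := isWeightedHomogeneous_zero _ _ _
  add_mem' hf hg c := (hf c).add (hg c)
  neg_mem' hf c := (hf c).neg

/-- The polynomial ring `S(-e)`. -/
noncomputable def polyPart (k : Type u) [Field k] (n : ℕ) (e j : ℤ) :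
    AddSubgroup (MvPolynomial (Fin n) k) :=
  (weightedHomogeneousSubmodule k (fun _ : Fin n => (1 : ℤ)) (j - e)).toAddSubgroup

theorem mem_polyPart {e j : ℤ} {f : S} : f ∈ polyPart k n e j ↔ InDegree f (j - e) := Iff.rfl

theorem inDegree_monomial (a : Fin n →₀ ℕ) (c : k) : InDegree (monomial a c) (a.degree : ℤ) :=
  isWeightedHomogeneous_monomial _ _ _ (by
    simp [Finsupp.weight_apply, Finsupp.degree_apply, Finsupp.sum])

theorem inDegree_iff {f : S} {j : ℤ} :
    InDegree f j ↔ ∀ a ∈ f.support, (a.degree : ℤ) = j := by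
  have h : ∀ a : Fin n →₀ ℕ, Finsupp.weight (fun _ : Fin n => (1 : ℤ)) a = a.degree := by
    intro a
    simp [Finsupp.weight_apply, Finsupp.degree_apply, Finsupp.sum]
  simp only [InDegree, IsWeightedHomogeneous, h, mem_support_iff]

/-- The homogeneous component of degree `j` of a polynomial. -/
noncomputable def component (k : Type u) [Field k] (n : ℕ) (j : ℤ) :
    MvPolynomial (Fin n) k →+ MvPolynomial (Fin n) k :=
  (weightedHomogeneousComponent (fun _ : Fin n => (1 : ℤ)) j).toAddMonoidHom

theorem component_mem (j : ℤ) (f : S) : InDegree (component k n j f) j :=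
  weightedHomogeneousComponent_mem _ f j

theorem component_same {j : ℤ} {f : S} (hf : InDegree f j) : component k n j f = f :=
  hf.weightedHomogeneousComponent_same

theorem component_ne {i j : ℤ} (hij : i ≠ j) {f : S} (hf : InDegree f i) :
    component k n j f = 0 :=
  hf.weightedHomogeneousComponent_ne _ hij.symm

theorem support_component_subset (j : ℤ) (f : S) : (component k n j f).support ⊆ f.support := by
  intro a ha
  rw [mem_support_iff] at ha ⊢
  intro h
  apply ha
  change coeff a (weightedHomogeneousComponent _ _ _) = 0
  rw [coeff_weightedHomogeneousComponent, h, ite_self]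

theorem isProjection_poly (e : ℤ) :
    IsProjection (polyPart k n e) (fun j => component k n (j - e)) := by
  refine .of_iSup (fun j f => component_mem _ _) (fun j f hf => component_same hf)
    (fun i j hij f hf => component_ne (by omega) hf) fun f => ?_
  induction f using MvPolynomial.induction_on' with
  | monomial a c =>
    refine AddSubgroup.mem_iSup_of_mem (a.degree + e) ?_
    rw [mem_polyPart, add_sub_cancel_right]
    exact inDegree_monomial a c
  | add p q hp hq => exact add_mem hp hq

theorem isGraded_poly (e : ℤ) : IsGraded k n (polyPart k n e) := by
  refine ⟨fun {i j f m} hf hm => ?_, _, isProjection_poly e⟩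
  rw [mem_polyPart, smul_eq_mul, add_sub_assoc]
  exact IsWeightedHomogeneous.mul hf hm

/-! ### Graded free modules. -/

section Free

variable {ι κ : Type u} {deg : ι → ℤ}

theorem single_mem_freePart {b : ι} {f : S} {j : ℤ} (hf : InDegree f (j - deg b)) :
    Finsupp.single b f ∈ freePart deg j := by
  classical
  intro c
  rw [Finsupp.single_apply]
  split_ifs with h
  · exact h ▸ hf
  · exact isWeightedHomogeneous_zero _ _ _

theorem single_one_mem_freePart (b : ι) : Finsupp.single b (1 : S) ∈ freePart deg (deg b) := by
  refine single_mem_freePart ?_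
  rw [sub_self]
  exact isWeightedHomogeneous_one _ _

theorem isGraded_free (deg : ι → ℤ) : IsGraded k n (freePart (k := k) (n := n) deg) := by
  classical
  refine ⟨fun {i j f m} hf hm c => ?_, fun j => Finsupp.liftAddHom fun c =>
    (Finsupp.singleAddHom c).comp (component k n (j - deg c)), ?_⟩
  · rw [Finsupp.smul_apply, smul_eq_mul, add_sub_assoc]
    exact IsWeightedHomogeneous.mul hf (hm c)
  have key : ∀ (j : ℤ) (x : ι →₀ S) (c : ι), (Finsupp.liftAddHom (fun c =>
      (Finsupp.singleAddHom c).comp (component k n (j - deg c))) x) c =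
        component k n (j - deg c) (x c) := by
    intro j x c
    induction x using Finsupp.induction_linear with
    | zero => simp
    | add x y hx hy => rw [map_add, Finsupp.add_apply, hx, hy, Finsupp.add_apply, map_add]
    | single b f =>
      rw [Finsupp.liftAddHom_apply_single, AddMonoidHom.comp_apply, Finsupp.singleAddHom_apply,
        Finsupp.single_apply, Finsupp.single_apply]
      split_ifs with h
      · rw [h]
      · rw [map_zero]
  refine .of_iSup ?_ ?_ ?_ ?_
  · intro j x c
    rw [key]
    exact component_mem _ _
  · intro j x hx
    ext1 c
    rw [key]
    exact component_same (hx c)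
  · intro i j hij x hx
    ext1 c
    rw [key]
    exact component_ne (by omega) (hx c)
  · intro x
    induction x using Finsupp.induction_linear with
    | zero => exact zero_mem _
    | add x y hx hy => exact add_mem hx hy
    | single b f =>
      obtain ⟨s, hs⟩ := (isProjection_poly (k := k) (n := n) (deg b)).sum f
      rw [← hs, ← Finsupp.singleAddHom_apply, map_sum]
      refine sum_mem fun j _ => AddSubgroup.mem_iSup_of_mem j ?_
      exact single_mem_freePart (component_mem _ _)

theorem map_eq_sum (f : (ι →₀ S) →ₗ[S] M) (x : ι →₀ S) :
    f x = x.sum fun b c => c • f (Finsupp.single b 1) := by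
  conv_lhs => rw [← Finsupp.sum_single x, Finsupp.sum, map_sum]
  refine Finset.sum_congr rfl fun b _ => ?_
  simp only [← map_smul, Finsupp.smul_single, smul_eq_mul, mul_one]

theorem isGradedHom_of_basis (hM : IsGraded k n ℳ) {f : (ι →₀ S) →ₗ[S] M}
    (hf : ∀ b, f (Finsupp.single b 1) ∈ ℳ (deg b)) : IsGradedHom (freePart deg) ℳ f := by
  intro j x hx
  rw [map_eq_sum]
  refine sum_mem fun b _ => ?_
  have := hM.smul_mem (hx b) (hf b)
  rwa [sub_add_cancel] at this

/-- Projectivity of graded free modules: choose homogeneous preimages for the images of the basis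
elements. -/
theorem IsGradedHom.exists_lift {f : M →ₗ[S] N} (hf : IsGradedHom ℳ 𝒩 f)
    (hM : IsGraded k n ℳ) (hN : IsGraded k n 𝒩) {φ : (ι →₀ S) →ₗ[S] N}
    (hφ : IsGradedHom (freePart deg) 𝒩 φ) (hr : LinearMap.range φ ≤ LinearMap.range f) :
    ∃ ψ : (ι →₀ S) →ₗ[S] M, IsGradedHom (freePart deg) ℳ ψ ∧ f ∘ₗ ψ = φ := by
  have h : ∀ b, ∃ m ∈ ℳ (deg b), f m = φ (Finsupp.single b 1) := fun b =>
    hf.exists_preimage hM hN (hφ _ _ (single_one_mem_freePart b)) (hr ⟨_, rfl⟩)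
  choose v hv hfv using h
  have e : ∀ b, Finsupp.linearCombination S v (Finsupp.single b 1) = v b := fun b => by simp
  refine ⟨Finsupp.linearCombination S v, isGradedHom_of_basis hM fun b => ?_, ?_⟩
  · rw [e]
    exact hv b
  · ext b
    simp [hfv]

end Free

end GradedModules

/-! ### Degree bounds on truncated resolutions, horseshoe lemma and mapping cones. -/

section RegularityBound

variable {k : Type u} [Field k] {n : ℕ}

local notation "S" => MvPolynomial (Fin n) k

/-- `M` has a graded free resolution whose terms `F_l`, for `l < i`, have bases of degrees
at most `r + l`. -/
def RegBound (k : Type u) [Field k] (n : ℕ) : ℕ → ∀ (M : Type u) [AddCommGroup M]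
    [Module (MvPolynomial (Fin n) k) M], (ℤ → AddSubgroup M) → ℤ → Prop
  | 0, _, _, _, _, _ => True
  | i + 1, M, _, _, ℳ, r => ∃ (ι : Type u) (deg : ι → ℤ)
      (ε : (ι →₀ MvPolynomial (Fin n) k) →ₗ[MvPolynomial (Fin n) k] M),
      (∀ b, deg b ≤ r) ∧ IsGradedHom (freePart deg) ℳ ε ∧ Function.Surjective ε ∧
        RegBound k n i (LinearMap.ker ε) (subPart (freePart deg) (LinearMap.ker ε)) (r + 1)

variable {A B C : Type u} [AddCommGroup A] [Module (MvPolynomial (Fin n) k) A]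
  [AddCommGroup B] [Module (MvPolynomial (Fin n) k) B] [AddCommGroup C]
  [Module (MvPolynomial (Fin n) k) C]
  {𝒜 : ℤ → AddSubgroup A} {ℬ : ℤ → AddSubgroup B} {𝒞 : ℤ → AddSubgroup C}

/-- One step of the horseshoe construction. The map `φ` only has to generate `B` modulo the image of
`f`; the preimage of that image under `φ` plays the role of the first syzygy of the cokernel, which
need not be named. -/
theorem exists_extension_cover {f : A →ₗ[S] B} (hf : IsGradedHom 𝒜 ℬ f) (hfi : Function.Injective f)
    {ι κ : Type u} {degA : ι → ℤ} {degC : κ → ℤ} {εA : (ι →₀ S) →ₗ[S] A}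
    (hε : IsGradedHom (freePart degA) 𝒜 εA) (hεs : Function.Surjective εA)
    {φ : (κ →₀ S) →ₗ[S] B} (hφ : IsGradedHom (freePart degC) ℬ φ)
    (hsup : ∀ b, ∃ a y, b = f a + φ y) :
    ∃ ε : (ι ⊕ κ →₀ S) →ₗ[S] B, IsGradedHom (freePart (Sum.elim degA degC)) ℬ ε ∧
      Function.Surjective ε ∧
      ∃ (p : LinearMap.ker εA →ₗ[S] LinearMap.ker ε)
        (q : LinearMap.ker ε →ₗ[S] (LinearMap.range f).comap φ),
        IsGradedHom (subPart (freePart degA) _) (subPart (freePart (Sum.elim degA degC)) _) p ∧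
        IsGradedHom (subPart (freePart (Sum.elim degA degC)) _) (subPart (freePart degC) _) q ∧
        Function.Injective p ∧ Function.Surjective q ∧ Function.Exact p q := by
  let e : (ι ⊕ κ →₀ S) ≃ₗ[S] (ι →₀ S) × (κ →₀ S) := Finsupp.sumFinsuppLEquivProdFinsupp S
  have e1 : ∀ x c, (e x).1 c = x (Sum.inl c) := fun x c => rfl
  have e2 : ∀ x c, (e x).2 c = x (Sum.inr c) := fun x c => rfl
  let ε : (ι ⊕ κ →₀ S) →ₗ[S] B := (LinearMap.coprod (f ∘ₗ εA) φ) ∘ₗ e.toLinearMap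
  have hεe : ∀ x, ε x = f (εA (e x).1) + φ (e x).2 := fun x => rfl
  have hps : ∀ x : LinearMap.ker εA, e.symm ((x : ι →₀ S), 0) ∈ LinearMap.ker ε := by
    intro x
    rw [LinearMap.mem_ker, hεe, e.apply_symm_apply]
    simp [LinearMap.mem_ker.1 x.2]
  have hqs : ∀ x : LinearMap.ker ε, (e (x : ι ⊕ κ →₀ S)).2 ∈ (LinearMap.range f).comap φ := by
    intro x
    have := LinearMap.mem_ker.1 x.2
    rw [hεe] at this
    exact ⟨-εA (e (x : ι ⊕ κ →₀ S)).1, by rw [map_neg, neg_eq_of_add_eq_zero_right this]⟩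
  let p : LinearMap.ker εA →ₗ[S] LinearMap.ker ε :=
    LinearMap.codRestrict _ (e.symm.toLinearMap ∘ₗ LinearMap.inl S _ _ ∘ₗ Submodule.subtype _) hps
  let q : LinearMap.ker ε →ₗ[S] (LinearMap.range f).comap φ :=
    LinearMap.codRestrict _ (LinearMap.snd S _ _ ∘ₗ e.toLinearMap ∘ₗ Submodule.subtype _) hqs
  have hp : ∀ x, e (p x : ι ⊕ κ →₀ S) = ((x : ι →₀ S), 0) := fun x => e.apply_symm_apply _
  have hq : ∀ x, (q x : κ →₀ S) = (e (x : ι ⊕ κ →₀ S)).2 := fun x => rfl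
  refine ⟨ε, ?_, ?_, p, q, ?_, ?_, ?_, ?_, ?_⟩
  · intro j x hx
    rw [hεe]
    exact add_mem (hf _ _ (hε _ _ fun c => hx (Sum.inl c))) (hφ _ _ fun c => hx (Sum.inr c))
  · intro b
    obtain ⟨a, y, rfl⟩ := hsup b
    obtain ⟨x, rfl⟩ := hεs a
    exact ⟨e.symm (x, y), by rw [hεe, e.apply_symm_apply]⟩
  · intro j x hx
    rintro (c | c)
    · change InDegree ((p x : ι ⊕ κ →₀ S) (Sum.inl c)) _
      rw [← e1, hp]
      exact hx c
    · change InDegree ((p x : ι ⊕ κ →₀ S) (Sum.inr c)) _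
      rw [← e2, hp]
      exact isWeightedHomogeneous_zero _ _ _
  · intro j x hx c
    exact hx (Sum.inr c)
  · intro x y hxy
    have := congrArg (fun z : LinearMap.ker ε => (e (z : ι ⊕ κ →₀ S)).1) hxy
    simp only [hp] at this
    exact Subtype.ext this
  · rintro ⟨y, a, ha⟩
    obtain ⟨x, rfl⟩ := hεs a
    refine ⟨⟨e.symm (-x, y), ?_⟩, Subtype.ext ?_⟩
    · rw [LinearMap.mem_ker, hεe, e.apply_symm_apply]
      simp [ha]
    · rw [hq, e.apply_symm_apply]
  · intro x
    constructor
    · intro hx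
      have h2 : (e (x : ι ⊕ κ →₀ S)).2 = 0 := by rw [← hq, hx]; rfl
      have hk := LinearMap.mem_ker.1 x.2
      rw [hεe, h2, map_zero, add_zero] at hk
      refine ⟨⟨(e (x : ι ⊕ κ →₀ S)).1, ?_⟩, Subtype.ext (e.injective ?_)⟩
      · exact hfi (hk.trans (map_zero f).symm)
      · rw [hp, ← h2]
    · rintro ⟨y, rfl⟩
      refine Subtype.ext ?_
      rw [hq, hp]
      rfl

/-- Horseshoe lemma: the kernels of the covers form a short exact sequence again, so the
construction iterates. -/
theorem RegBound.extension (i : ℕ) {r : ℤ} (hA : IsGraded k n 𝒜) (hB : IsGraded k n ℬ)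
    (hC : IsGraded k n 𝒞) {f : A →ₗ[S] B} {g : B →ₗ[S] C} (hf : IsGradedHom 𝒜 ℬ f)
    (hg : IsGradedHom ℬ 𝒞 g) (hfi : Function.Injective f) (hgs : Function.Surjective g)
    (hfg : Function.Exact f g) (hrA : RegBound k n i A 𝒜 r) (hrC : RegBound k n i C 𝒞 r) :
    RegBound k n i B ℬ r := by
  induction i generalizing A B C r with
  | zero => trivial
  | succ i ih =>
    obtain ⟨ι, degA, εA, hdA, hεA, hsA, hkA⟩ := hrA
    obtain ⟨κ, degC, εC, hdC, hεC, hsC, hkC⟩ := hrC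
    obtain ⟨φ, hφ, hφg⟩ := hg.exists_lift hB hC hεC
      (by rw [LinearMap.range_eq_top.2 hgs]; exact le_top)
    have hφg' : ∀ y, g (φ y) = εC y := fun y => LinearMap.congr_fun hφg y
    obtain ⟨ε, hε, hεs, p, q, hp, hq, hpi, hqs, hpq⟩ := exists_extension_cover hf hfi hεA hsA hφ
      (fun b => by
        obtain ⟨y, hy⟩ := hsC (g b)
        obtain ⟨a, ha⟩ := (hfg (b - φ y)).1 (by rw [map_sub, hφg', hy, sub_self])
        exact ⟨a, y, by rw [ha, sub_add_cancel]⟩)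
    refine ⟨ι ⊕ κ, Sum.elim degA degC, ε, ?_, hε, hεs, ?_⟩
    · rintro (b | b)
      exacts [hdA b, hdC b]
    · refine ih ((isGraded_free _).ker hA hεA) ((isGraded_free _).ker hB hε)
        (hA.comap hB (isGraded_free _) hf hφ) hp hq hpi hqs hpq hkA ?_
      have : (LinearMap.range f).comap φ = LinearMap.ker εC := by
        ext y
        rw [Submodule.mem_comap, LinearMap.mem_ker, ← hφg']
        exact (hfg _).symm
      rw [this]
      exact hkC

theorem RegBound.of_cover {i : ℕ} {r : ℤ} (hA : IsGraded k n 𝒜) (hB : IsGraded k n ℬ)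
    {f : A →ₗ[S] B} (hf : IsGradedHom 𝒜 ℬ f) (hfi : Function.Injective f)
    (hrA : RegBound k n (i + 1) A 𝒜 r)
    {κ : Type u} {degC : κ → ℤ} (hdC : ∀ c, degC c ≤ r) {φ : (κ →₀ S) →ₗ[S] B}
    (hφ : IsGradedHom (freePart degC) ℬ φ) (hsup : ∀ b, ∃ a y, b = f a + φ y)
    (hL : RegBound k n i ((LinearMap.range f).comap φ) (subPart (freePart degC) _) (r + 1)) :
    RegBound k n (i + 1) B ℬ r := by
  obtain ⟨ι, degA, εA, hdA, hεA, hsA, hkA⟩ := hrA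
  obtain ⟨ε, hε, hεs, p, q, hp, hq, hpi, hqs, hpq⟩ :=
    exists_extension_cover hf hfi hεA hsA hφ hsup
  refine ⟨ι ⊕ κ, Sum.elim degA degC, ε, ?_, hε, hεs, ?_⟩
  · rintro (b | b)
    exacts [hdA b, hdC b]
  · exact hkA.extension i ((isGraded_free _).ker hA hεA) ((isGraded_free _).ker hB hε)
      (hA.comap hB (isGraded_free _) hf hφ) hp hq hpi hqs hpq hL

theorem regBound_of_subsingleton [Subsingleton A] (i : ℕ) (r : ℤ) : RegBound k n i A 𝒜 r := by
  induction i generalizing A r with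
  | zero => trivial
  | succ i ih =>
    refine ⟨PEmpty, PEmpty.elim, 0, fun b => b.elim, isGradedHom_zero,
      fun a => ⟨0, Subsingleton.elim _ _⟩, ih _⟩

theorem RegBound.of_equiv {i : ℕ} {r : ℤ} (e : A ≃ₗ[S] B) (he : IsGradedHom 𝒜 ℬ e.toLinearMap) (h : RegBound k n i A 𝒜 r) :
    RegBound k n i B ℬ r := by
  cases i with
  | zero => trivial
  | succ i =>
    obtain ⟨ι, degA, εA, hdA, hεA, hsA, hkA⟩ := h
    refine ⟨ι, degA, e.toLinearMap ∘ₗ εA, hdA, he.comp hεA, e.surjective.comp hsA, ?_⟩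
    rw [LinearEquiv.ker_comp]
    exact hkA

/-- The grading of the ideal `I`, shifted by `e`. -/
noncomputable def idealShift (I : Ideal S) (e : ℤ) : ℤ → AddSubgroup I :=
  subPart (polyPart k n e) I

theorem idealShift_zero (I : Ideal S) : idealShift I 0 = idealPart I := by
  funext j
  ext x
  rw [idealShift, mem_subPart, mem_polyPart, sub_zero]
  rfl

/-- Ideals containing the homogeneous components of their elements. -/
def IsHomogeneousIdeal (I : Ideal S) : Prop := ∀ j, ∀ f ∈ I, component k n j f ∈ I

theorem IsHomogeneousIdeal.isGraded {I : Ideal S} (hI : IsHomogeneousIdeal I) (e : ℤ) :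
    IsGraded k n (idealShift I e) :=
  (isGraded_poly e).submodule (isProjection_poly e) I fun j f hf => hI (j - e) f hf

/-- Mapping cone for adding one generator: `I / I'` is cyclic, generated by `u` in degree `e + b`,
and its first syzygy is the colon ideal `L` with the corresponding shift. As a syzygy, `L` is needed
for one step fewer and may have bound `r + 1`. -/
theorem RegBound.sup_span_singleton {i : ℕ} {r e b : ℤ} {I I' L : Ideal S}
    (hI : IsHomogeneousIdeal I) (hI' : IsHomogeneousIdeal I')
    {u : S} (hu : InDegree u b) (hsup : I = I' ⊔ Ideal.span {u})
    (hcolon : ∀ f, f ∈ L ↔ f * u ∈ I') (hbr : e + b ≤ r)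
    (h' : RegBound k n (i + 1) I' (idealShift I' e) r)
    (hrL : RegBound k n i L (idealShift L (e + b)) (r + 1)) :
    RegBound k n (i + 1) I (idealShift I e) r := by
  have hle : I' ≤ I := hsup ▸ le_sup_left
  have huI : u ∈ I := hsup ▸ Submodule.mem_sup_right (Ideal.mem_span_singleton_self u)
  let f : I' →ₗ[S] I := Submodule.inclusion hle
  let φ : (PUnit.{u + 1} →₀ S) →ₗ[S] I := Finsupp.linearCombination S fun _ => ⟨u, huI⟩
  have hφ : ∀ x, (φ x : S) = x PUnit.unit * u := by
    intro x
    have : x = Finsupp.single PUnit.unit (x PUnit.unit) := by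
      ext1
      simp
    conv_lhs => rw [this]
    simp only [φ, Finsupp.linearCombination_single]
    rfl
  have hφg : IsGradedHom (freePart fun _ => e + b) (idealShift I e) φ := by
    intro j x hx
    rw [idealShift, mem_subPart, mem_polyPart, hφ]
    have : InDegree (x PUnit.unit) (j - (e + b)) := hx PUnit.unit
    have := IsWeightedHomogeneous.mul this hu
    rwa [show j - (e + b) + b = j - e by ring] at this
  have hc : ∀ x, x ∈ (LinearMap.range f).comap φ ↔ x PUnit.unit ∈ L := by
    intro x
    rw [hcolon, ← hφ]
    constructor
    · rintro ⟨a, ha⟩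
      rw [← ha]
      exact a.2
    · intro h
      exact ⟨⟨_, h⟩, Subtype.ext rfl⟩
  let ψ : L →ₗ[S] (LinearMap.range f).comap φ :=
    LinearMap.codRestrict _ (Finsupp.lsingle PUnit.unit ∘ₗ L.subtype) fun x => by
      rw [hc]
      simp
  have hψ : ∀ x, (ψ x : PUnit.{u + 1} →₀ S) = Finsupp.single PUnit.unit (x : S) := fun x => rfl
  have hψb : Function.Bijective ψ := by
    constructor
    · intro x y hxy
      have := congrArg (fun z : (LinearMap.range f).comap φ =>
        (z : PUnit.{u + 1} →₀ S) PUnit.unit) hxy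
      simpa [hψ] using this
    · rintro ⟨x, hx⟩
      refine ⟨⟨x PUnit.unit, (hc x).1 hx⟩, Subtype.ext ?_⟩
      rw [hψ]
      ext1
      simp
  have hfg : IsGradedHom (idealShift I' e) (idealShift I e) f := fun j x hx => hx
  refine RegBound.of_cover (hI'.isGraded e) (hI.isGraded e) hfg
    (Submodule.inclusion_injective hle) h' (fun _ => hbr) hφg ?_ ?_
  · rintro ⟨x, hx⟩
    rw [hsup, Submodule.mem_sup] at hx
    obtain ⟨y, hy, z, hz, rfl⟩ := hx
    obtain ⟨c, rfl⟩ := Ideal.mem_span_singleton'.1 hz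
    refine ⟨⟨y, hy⟩, Finsupp.single PUnit.unit c, Subtype.ext ?_⟩
    rw [Submodule.coe_add, hφ]
    simp [f]
  · refine RegBound.of_equiv (LinearEquiv.ofBijective ψ hψb) ?_ hrL
    intro j x hx
    exact single_mem_freePart hx

end RegularityBound

/-! ### From degree bounds to Betti numbers of arbitrary resolutions. -/

section Vanishing

variable {k : Type u} [Field k] {n : ℕ}

local notation "S" => MvPolynomial (Fin n) k

/-- The ideal `(x₁, …, xₙ)`. -/
noncomputable def irrelevant (k : Type u) [Field k] (n : ℕ) : Ideal (MvPolynomial (Fin n) k) :=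
  RingHom.ker constantCoeff

variable {ι κ : Type u} {M : Type u} [AddCommGroup M] [Module (MvPolynomial (Fin n) k) M]
  {ℳ : ℤ → AddSubgroup M}

/-- The image in `F ⊗ k` of an element of the free module `F`. -/
noncomputable def constTerms (x : ι →₀ S) : ι →₀ k :=
  x.mapRange constantCoeff (map_zero _)

theorem constTerms_sub (x y : ι →₀ S) : constTerms (x - y) = constTerms x - constTerms y := by
  ext c
  simp [constTerms]

theorem constTerms_smul (f : S) (x : ι →₀ S) :
    constTerms (f • x) = constantCoeff f • constTerms x := by
  ext c
  simp [constTerms]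

theorem constTerms_add (x y : ι →₀ S) : constTerms (x + y) = constTerms x + constTerms y := by
  ext c
  simp [constTerms]

theorem constTerms_map (f : (ι →₀ S) →ₗ[S] (κ →₀ S)) (x : ι →₀ S) :
    constTerms (f x) = Finsupp.linearCombination k
      (fun b => constTerms (f (Finsupp.single b 1))) (constTerms x) := by
  induction x using Finsupp.induction_linear with
  | zero =>
    have h : ∀ ν : Type u, constTerms (0 : ν →₀ S) = 0 := fun ν => Finsupp.mapRange_zero
    rw [map_zero, h, h, map_zero]
  | add x y hx hy => rw [map_add, constTerms_add, constTerms_add, map_add, hx, hy]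
  | single b c =>
    have h : Finsupp.single b c = c • Finsupp.single b (1 : S) := by simp
    rw [h, map_smul, constTerms_smul, constTerms_smul, map_smul]
    congr 1
    have : constTerms (Finsupp.single b (1 : S)) = Finsupp.single b 1 := by
      rw [constTerms, Finsupp.mapRange_single, map_one]
    rw [this, Finsupp.linearCombination_single, one_smul]

theorem map_mem_irrelevant_smul (f : (ι →₀ S) →ₗ[S] M) {x : ι →₀ S} (hx : constTerms x = 0) :
    f x ∈ irrelevant k n • (⊤ : Submodule S M) := by
  rw [map_eq_sum]
  refine sum_mem fun b _ => Submodule.smul_mem_smul ?_ trivial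
  exact DFunLike.congr_fun hx b

theorem exists_constTerms_eq_zero {ε : (ι →₀ S) →ₗ[S] M} (hε : Function.Surjective ε) {m : M}
    (hm : m ∈ irrelevant k n • (⊤ : Submodule S M)) : ∃ x, constTerms x = 0 ∧ ε x = m := by
  refine Submodule.smul_induction_on hm ?_ ?_
  · intro f hf y _
    obtain ⟨x, rfl⟩ := hε y
    refine ⟨f • x, ?_, map_smul _ _ _⟩
    rw [constTerms_smul, show constantCoeff f = 0 from hf, zero_smul]
  · rintro _ _ ⟨x, hx, rfl⟩ ⟨y, hy, rfl⟩
    exact ⟨x + y, by rw [constTerms_add, hx, hy, add_zero], map_add _ _ _⟩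

theorem constantCoeff_eq_zero_of_inDegree {f : S} {j : ℤ} (hf : InDegree f j) (hj : j ≠ 0) :
    constantCoeff f = 0 := by
  by_contra h
  refine hj ?_
  have := inDegree_iff.1 hf 0 (by rwa [mem_support_iff, ← constantCoeff_eq])
  simpa using this.symm

theorem constTerms_apply_eq_zero {deg : ι → ℤ} {j : ℤ} {x : ι →₀ S} (hx : x ∈ freePart deg j)
    {c : ι} (hc : deg c ≠ j) : constTerms x c = 0 :=
  constantCoeff_eq_zero_of_inDegree (hx c) (sub_ne_zero.2 hc.symm)

theorem exists_mem_freePart_constTerms_eq {deg : ι → ℤ} {j : ℤ} {z : ι →₀ k}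
    (hz : z ∈ Finsupp.supported k k {b | deg b = j}) :
    ∃ x ∈ freePart (n := n) deg j, constTerms x = z := by
  refine ⟨z.mapRange C (map_zero _), fun c => ?_, ?_⟩
  · rw [Finsupp.mapRange_apply]
    by_cases hc : z c = 0
    · rw [hc, map_zero]
      exact isWeightedHomogeneous_zero _ _ _
    · have : deg c = j := hz (by simpa using hc)
      rw [this, sub_self]
      exact isWeightedHomogeneous_C _ _
  · ext c
    simp [constTerms]

/-- The identity of `M` factors through a module with `RegBound i r`, up to a map factoring
through the map `p` to a free module. -/
def Dominated (ℳ : ℤ → AddSubgroup M) (deg : κ → ℤ) (p : M →ₗ[S] (κ →₀ S)) (i : ℕ) (r : ℤ) :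
    Prop :=
  ∃ (N : Type u) (_ : AddCommGroup N) (_ : Module (MvPolynomial (Fin n) k) N)
    (𝒩 : ℤ → AddSubgroup N), IsGraded k n 𝒩 ∧ RegBound k n i N 𝒩 r ∧
    ∃ (a : M →ₗ[S] N) (b : N →ₗ[S] M) (h : (κ →₀ S) →ₗ[S] M), IsGradedHom ℳ 𝒩 a ∧
      IsGradedHom 𝒩 ℳ b ∧ IsGradedHom (freePart deg) ℳ h ∧ ∀ m, b (a m) = m + h (p m)

theorem RegBound.dominated {i : ℕ} {r : ℤ} (hM : IsGraded k n ℳ) (h : RegBound k n i M ℳ r) :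
    Dominated ℳ (PEmpty.elim : PEmpty → ℤ) (0 : M →ₗ[S] (PEmpty →₀ S)) i r :=
  ⟨M, _, _, ℳ, hM, h, LinearMap.id, LinearMap.id, 0, isGradedHom_id, isGradedHom_id,
    isGradedHom_zero, by simp⟩

/-- The comparison theorem, one syzygy at a time: lifts of `a` and `b` to the free covers restrict
to the kernels, and the error there factors through the inclusion of the kernel in its free module.
-/
theorem Dominated.ker {deg : κ → ℤ} {p : M →ₗ[S] (κ →₀ S)} {i : ℕ} {r : ℤ}
    (hM : IsGraded k n ℳ) (hp : IsGradedHom ℳ (freePart deg) p)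
    (hD : Dominated ℳ deg p (i + 1) r) {deg' : ι → ℤ} {ε : (ι →₀ S) →ₗ[S] M}
    (hε : IsGradedHom (freePart deg') ℳ ε) (hεs : Function.Surjective ε) :
    Dominated (subPart (freePart deg') (LinearMap.ker ε)) deg' (LinearMap.ker ε).subtype i
      (r + 1) := by
  obtain ⟨N, _, _, 𝒩, hN, ⟨ν, degN, εN, hdN, hεN, hsN, hkN⟩, a, b, h, ha, hb, hh, hbah⟩ := hD
  have top : ∀ {P Q : Type u} [AddCommGroup P] [Module (MvPolynomial (Fin n) k) P]
      [AddCommGroup Q] [Module (MvPolynomial (Fin n) k) Q] {f : P →ₗ[S] Q},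
      Function.Surjective f → ∀ T : Submodule S Q, T ≤ LinearMap.range f := by
    intro P Q _ _ _ _ f hf T
    rw [LinearMap.range_eq_top.2 hf]
    exact le_top
  obtain ⟨α, hα, hαε⟩ := hεN.exists_lift (isGraded_free _) hN (ha.comp hε) (top hsN _)
  obtain ⟨β, hβ, hβε⟩ := hε.exists_lift (isGraded_free _) hM (hb.comp hεN) (top hεs _)
  obtain ⟨h', hh', hhε⟩ := hε.exists_lift (isGraded_free _) hM hh (top hεs _)
  have hα' : ∀ x, εN (α x) = a (ε x) := LinearMap.congr_fun hαε
  have hβ' : ∀ x, ε (β x) = b (εN x) := LinearMap.congr_fun hβε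
  have hh'' : ∀ x, ε (h' x) = h x := LinearMap.congr_fun hhε
  -- The last term corrects for `h ∘ p`, so that `H` takes values in `ker ε`. It vanishes on `ker
  -- ε`, where `H` is therefore `β ∘ α - id`.
  let H : (ι →₀ S) →ₗ[S] (ι →₀ S) := β ∘ₗ α - LinearMap.id - h' ∘ₗ p ∘ₗ ε
  have hH : ∀ x, H x = β (α x) - x - h' (p (ε x)) := fun x => rfl
  have hHg : IsGradedHom (freePart deg') (freePart deg') H :=
    ((hβ.comp hα).sub isGradedHom_id).sub (hh'.comp (hp.comp hε))
  refine ⟨LinearMap.ker εN, _, _, _, (isGraded_free _).ker hN hεN, hkN,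
    LinearMap.codRestrict _ (α ∘ₗ Submodule.subtype _) fun x => ?_,
    LinearMap.codRestrict _ (β ∘ₗ Submodule.subtype _) fun x => ?_,
    LinearMap.codRestrict _ H fun x => ?_,
    fun j x hx => hα j x hx, fun j x hx => hβ j x hx, fun j x hx => hHg j x hx, fun x => ?_⟩
  · change εN (α x) = 0
    rw [hα', LinearMap.mem_ker.1 x.2, map_zero]
  · change ε (β x) = 0
    rw [hβ', LinearMap.mem_ker.1 x.2, map_zero]
  · rw [LinearMap.mem_ker, hH, map_sub, map_sub, hβ', hα', hh'', hbah]
    abel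
  · refine Subtype.ext ?_
    change β (α x) = x + H x
    rw [hH, LinearMap.mem_ker.1 x.2, map_zero, map_zero]
    abel

/-- The bounded module has generators in degrees at most `r < j`, so `a m` is a combination of them
without constant coefficients. Hence `b (a m)` lies in `(x₁, …, xₙ) M`; by `hpm` so does the error
`h (p m)`. -/
theorem Dominated.mem_irrelevant_smul {deg : κ → ℤ} {p : M →ₗ[S] (κ →₀ S)} {r j : ℤ}
    (hD : Dominated ℳ deg p 1 r) (hj : r < j) {m : M} (hm : m ∈ ℳ j)
    (hpm : constTerms (p m) = 0) : m ∈ irrelevant k n • (⊤ : Submodule S M) := by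
  obtain ⟨N, _, _, 𝒩, hN, ⟨ν, degN, εN, hdN, hεN, hsN, -⟩, a, b, h, ha, hb, hh, hbah⟩ := hD
  obtain ⟨w, hw, hwa⟩ := hεN.exists_preimage (isGraded_free _) hN (ha j m hm) (hsN _)
  have hw0 : constTerms w = 0 := by
    ext c
    exact constTerms_apply_eq_zero hw (by have := hdN c; omega)
  have h1 := map_mem_irrelevant_smul (b ∘ₗ εN) hw0
  rw [LinearMap.comp_apply, hwa, hbah] at h1
  simpa using sub_mem h1 (map_mem_irrelevant_smul h hpm)

theorem Dominated.exists_mem_ker {deg : κ → ℤ} {p : M →ₗ[S] (κ →₀ S)} {r j : ℤ}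
    (hD : Dominated ℳ deg p 1 r) (hj : r < j) {deg' : ι → ℤ} {ε : (ι →₀ S) →ₗ[S] M}
    (hε : IsGradedHom (freePart deg') ℳ ε) (hεs : Function.Surjective ε) {z : ι →₀ S}
    (hz : z ∈ freePart deg' j) (hpz : constTerms (p (ε z)) = 0) :
    ∃ x ∈ LinearMap.ker ε, constTerms x = constTerms z := by
  obtain ⟨y, hy, hyz⟩ := exists_constTerms_eq_zero hεs
    (hD.mem_irrelevant_smul hj (hε j z hz) hpz)
  exact ⟨z - y, by rw [LinearMap.mem_ker, map_sub, hyz, sub_self],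
    by rw [constTerms_sub, hy, sub_zero]⟩

/-! ### Vanishing and nonvanishing of graded Betti numbers. -/

namespace GradedFreeResolution

variable (F : GradedFreeResolution k n ℳ)

theorem isGradedHom_ε (hM : IsGraded k n ℳ) : IsGradedHom (freePart (F.deg 0)) ℳ F.ε :=
  isGradedHom_of_basis hM F.ε_homogeneous

theorem isGradedHom_d (i : ℕ) :
    IsGradedHom (freePart (F.deg (i + 1))) (freePart (F.deg i)) (F.d i) :=
  isGradedHom_of_basis (isGraded_free _) fun b c => F.d_homogeneous i b c

theorem dBar_constTerms (i : ℕ) (x : F.ι (i + 1) →₀ S) :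
    F.dBar i (constTerms x) = constTerms (F.d i x) :=
  (constTerms_map (F.d i) x).symm

/-- The syzygy modules in `F_i`. -/
noncomputable def syzygy : ∀ i : ℕ, Submodule S (F.ι i →₀ S)
  | 0 => LinearMap.ker F.ε
  | i + 1 => LinearMap.ker (F.d i)

theorem mem_syzygy {i : ℕ} {x : F.ι i →₀ S} : x ∈ F.syzygy i ↔ ∃ y, F.d i y = x := by
  cases i with
  | zero => exact F.exact_ε x
  | succ i => exact F.exact_d i x

/-- The differential, as a map onto the syzygy module. -/
noncomputable def toSyzygy (i : ℕ) : (F.ι (i + 1) →₀ S) →ₗ[S] F.syzygy i :=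
  LinearMap.codRestrict _ (F.d i) fun x => F.mem_syzygy.2 ⟨x, rfl⟩

theorem toSyzygy_surjective (i : ℕ) : Function.Surjective (F.toSyzygy i) := by
  rintro ⟨x, hx⟩
  obtain ⟨y, hy⟩ := F.mem_syzygy.1 hx
  exact ⟨y, Subtype.ext hy⟩

theorem ker_toSyzygy (i : ℕ) : LinearMap.ker (F.toSyzygy i) = F.syzygy (i + 1) :=
  LinearMap.ker_codRestrict _ _ _

theorem isGradedHom_toSyzygy (i : ℕ) :
    IsGradedHom (freePart (F.deg (i + 1))) (subPart (freePart (F.deg i)) (F.syzygy i))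
      (F.toSyzygy i) :=
  fun j x hx => F.isGradedHom_d i j x hx

theorem isGraded_syzygy (hM : IsGraded k n ℳ) (i : ℕ) :
    IsGraded k n (subPart (freePart (F.deg i)) (F.syzygy i)) := by
  cases i with
  | zero => exact (isGraded_free _).ker hM (F.isGradedHom_ε hM)
  | succ i => exact (isGraded_free _).ker (isGraded_free _) (F.isGradedHom_d i)

/-- The syzygy inside `F_l` is the `(l + 1)`-st one, whence the bound `r + 1 + l`. Each passage to a
kernel uses up one level of `RegBound`, so the induction must keep `i` free. -/
theorem dominated_syzygy (hM : IsGraded k n ℳ) {r : ℤ} (h : ∀ i, RegBound k n i M ℳ r) (i l : ℕ) :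
    Dominated (subPart (freePart (F.deg l)) (F.syzygy l)) (F.deg l) (F.syzygy l).subtype i
      (r + 1 + l) := by
  induction l generalizing i with
  | zero =>
    have := ((h (i + 1)).dominated hM).ker hM isGradedHom_zero (F.isGradedHom_ε hM)
      F.ε_surjective
    rwa [Nat.cast_zero, add_zero]
  | succ l ih =>
    have := (ih (i + 1)).ker (F.isGraded_syzygy hM l) (isGradedHom_subtype _)
      (F.isGradedHom_toSyzygy l) (F.toSyzygy_surjective l)
    rw [ker_toSyzygy] at this
    rwa [Nat.cast_succ, ← add_assoc]

theorem betti_ne_zero_iff (i : ℕ) (j : ℤ) :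
    F.betti i j ≠ 0 ↔ ∃ z ∈ F.cyclesInDegree i j, z ∉ LinearMap.range (F.dBar i) := by
  rw [betti, ne_eq, rank_zero_iff, Submodule.Quotient.subsingleton_iff,
    Submodule.comap_subtype_eq_top, SetLike.not_le_iff_exists]

theorem betti_eq_zero (hM : IsGraded k n ℳ) {r : ℤ} (h : ∀ i, RegBound k n i M ℳ r) {i : ℕ}
    {j : ℤ} (hj : r < j - i) : F.betti i j = 0 := by
  by_contra hb
  obtain ⟨z, ⟨hzc, hzj⟩, hzr⟩ := (F.betti_ne_zero_iff i j).1 hb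
  obtain ⟨x, hx, rfl⟩ := exists_mem_freePart_constTerms_eq (n := n) hzj
  apply hzr
  -- A cycle of `F ⊗ k` is a boundary once it lifts to a syzygy of `F`, because `F` is exact.
  suffices hs : ∃ y ∈ F.syzygy i, constTerms y = constTerms x by
    obtain ⟨y, hy, hyx⟩ := hs
    obtain ⟨w, rfl⟩ := F.mem_syzygy.1 hy
    exact ⟨constTerms w, by rw [dBar_constTerms, hyx]⟩
  cases i with
  | zero =>
    refine ((h 1).dominated hM).exists_mem_ker (by simpa using hj) (F.isGradedHom_ε hM)
      F.ε_surjective hx ?_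
    exact Subsingleton.elim _ _
  | succ i =>
    have := (F.dominated_syzygy hM h 1 i).exists_mem_ker (j := j) (by push_cast at hj; linarith)
      (F.isGradedHom_toSyzygy i) (F.toSyzygy_surjective i) hx ?_
    · rwa [ker_toSyzygy] at this
    · change constTerms (F.d i x) = 0
      rw [← dBar_constTerms]
      exact hzc

/-- Tor₀ is `M / (x₁, …, xₙ) M`: if the class of a lift of `m` were a boundary, subtracting an
element of the image of `d 0` would leave a lift without constant terms. -/
theorem betti_zero_ne_zero (hM : IsGraded k n ℳ) {j : ℤ} {m : M} (hm : m ∈ ℳ j)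
    (hm' : m ∉ irrelevant k n • (⊤ : Submodule S M)) : F.betti 0 j ≠ 0 := by
  obtain ⟨x, hx, rfl⟩ := (F.isGradedHom_ε hM).exists_preimage (isGraded_free _) hM hm
    (F.ε_surjective m)
  refine (F.betti_ne_zero_iff 0 j).2 ⟨constTerms x, ⟨trivial, ?_⟩, ?_⟩
  · intro c hc
    by_contra hcj
    exact Finsupp.mem_support_iff.1 hc (constTerms_apply_eq_zero hx hcj)
  · rintro ⟨w, hw⟩
    obtain ⟨y, rfl⟩ : ∃ y : F.ι 1 →₀ S, constTerms y = w :=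
      ⟨w.mapRange C (map_zero _), by ext c; simp [constTerms]⟩
    rw [dBar_constTerms] at hw
    have h0 : constTerms (x - F.d 0 y) = 0 := by rw [constTerms_sub, hw, sub_self]
    have := map_mem_irrelevant_smul F.ε h0
    rw [map_sub, (F.exact_ε _).2 ⟨y, rfl⟩, sub_zero] at this
    exact hm' this

end GradedFreeResolution

/-- A bundled graded module. -/
structure GradedModuleData (k : Type u) [Field k] (n : ℕ) where
  /-- The underlying type. -/
  carrier : Type u
  [addCommGroup : AddCommGroup carrier]
  [module : Module (MvPolynomial (Fin n) k) carrier]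
  /-- The homogeneous parts. -/
  part : ℤ → AddSubgroup carrier
  isGraded : IsGraded k n part

attribute [instance] GradedModuleData.addCommGroup GradedModuleData.module

/-! ### Existence of graded free resolutions. -/

namespace GradedModuleData

variable (X : GradedModuleData k n)

/-- The index set of the canonical free cover: all homogeneous elements. -/
abbrev Gen : Type u := Σ j : ℤ, X.part j

/-- The canonical free cover. -/
noncomputable def cover : (X.Gen →₀ S) →ₗ[S] X.carrier :=
  Finsupp.linearCombination S fun b => (b.2 : X.carrier)

theorem cover_single (b : X.Gen) : X.cover (Finsupp.single b 1) = b.2 := by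
  rw [cover, Finsupp.linearCombination_single, one_smul]

theorem isGradedHom_cover :
    IsGradedHom (freePart fun b : X.Gen => b.1) X.part X.cover :=
  isGradedHom_of_basis X.isGraded fun b => by
    rw [cover_single]
    exact b.2.2

theorem cover_surjective : Function.Surjective X.cover := by
  intro m
  obtain ⟨π, hπ⟩ := X.isGraded.exists_projection
  obtain ⟨s, hs⟩ := hπ.sum m
  refine ⟨∑ j ∈ s, Finsupp.single ⟨j, π j m, hπ.mem j m⟩ 1, ?_⟩
  rw [map_sum]
  simp only [cover_single]
  exact hs

/-- The kernel of the canonical free cover. -/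
noncomputable def next : GradedModuleData k n where
  carrier := LinearMap.ker X.cover
  part := subPart (freePart fun b : X.Gen => b.1) (LinearMap.ker X.cover)
  isGraded := (isGraded_free _).ker X.isGraded X.isGradedHom_cover

/-- The iterated kernels of canonical free covers. -/
noncomputable def iter : ℕ → GradedModuleData k n
  | 0 => X
  | i + 1 => (iter i).next

/-- The canonical free resolution. -/
noncomputable def resolution : GradedFreeResolution k n X.part where
  ι i := (X.iter i).Gen
  deg _ b := b.1
  d i := (LinearMap.ker (X.iter i).cover).subtype ∘ₗ (X.iter (i + 1)).cover
  ε := X.cover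
  d_homogeneous i b c := by
    have := (X.iter (i + 1)).isGradedHom_cover b.1 (Finsupp.single b 1)
      (single_one_mem_freePart b)
    exact this c
  ε_homogeneous b := X.isGradedHom_cover b.1 _ (single_one_mem_freePart b)
  exact_d i x := by
    constructor
    · intro hx
      have hx' : (X.iter (i + 1)).cover x = 0 := Subtype.ext hx
      obtain ⟨y, hy⟩ := (X.iter (i + 2)).cover_surjective ⟨x, hx'⟩
      exact ⟨y, congrArg Subtype.val hy⟩
    · rintro ⟨y, rfl⟩
      have h : (X.iter (i + 1)).cover ((X.iter (i + 2)).cover y).1 = 0 :=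
        LinearMap.mem_ker.1 ((X.iter (i + 2)).cover y).2
      exact congrArg (fun z : LinearMap.ker (X.iter i).cover => (z : (X.iter i).Gen →₀ S)) h
  exact_ε x := by
    constructor
    · intro hx
      obtain ⟨y, hy⟩ := (X.iter 1).cover_surjective ⟨x, hx⟩
      exact ⟨y, congrArg Subtype.val hy⟩
    · rintro ⟨y, rfl⟩
      exact ((X.iter 1).cover y).2
  ε_surjective := X.cover_surjective

end GradedModuleData

theorem hasRegularity_of_regBound (hM : IsGraded k n ℳ) {r : ℤ}
    (h : ∀ i, RegBound k n i M ℳ r) {m : M} (hm : m ∈ ℳ r)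
    (hm' : m ∉ irrelevant k n • (⊤ : Submodule S M)) : HasRegularity k n ℳ r := by
  refine ⟨⟨GradedModuleData.resolution ⟨M, ℳ, hM⟩⟩, fun F => ⟨⟨0, r, ?_, by simp⟩, ?_⟩⟩
  · exact F.betti_zero_ne_zero hM hm hm'
  · rintro _ ⟨i, j, hb, rfl⟩
    by_contra hlt
    exact hb (F.betti_eq_zero hM h (not_le.1 hlt))

end Vanishing

/-! ### Combinatorics of stable sets of exponents. -/

section Exponents

variable {n : ℕ}

/-- The exponents of the monomials of a stable ideal. -/
def IsStableSet (A : Set (Fin n →₀ ℕ)) : Prop :=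
  IsUpperSet A ∧ ∀ a ∈ A, ∀ t : Fin n, IsGreatest {l | a l ≠ 0} t → ∀ i < t,
    a - Finsupp.single t 1 + Finsupp.single i 1 ∈ A

theorem move_apply (a : Fin n →₀ ℕ) (t i l : Fin n) :
    (a - Finsupp.single t 1 + Finsupp.single i 1 : Fin n →₀ ℕ) l =
      a l - (if t = l then 1 else 0) + (if i = l then 1 else 0) := by
  rw [Finsupp.add_apply, Finsupp.tsub_apply, Finsupp.single_apply, Finsupp.single_apply]

theorem single_one_le {a : Fin n →₀ ℕ} {t : Fin n} (h : a t ≠ 0) : Finsupp.single t 1 ≤ a := by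
  rw [Finsupp.single_le_iff]
  omega

theorem map_move {α : Type*} [AddCommMonoid α] (f : (Fin n →₀ ℕ) →+ α) {a : Fin n →₀ ℕ}
    {t : Fin n} (h : a t ≠ 0) (i : Fin n) :
    f (a - Finsupp.single t 1 + Finsupp.single i 1) + f (Finsupp.single t 1) =
      f a + f (Finsupp.single i 1) := by
  rw [← map_add, ← map_add, add_right_comm, tsub_add_cancel_of_le (single_one_le h)]

theorem degree_move {a : Fin n →₀ ℕ} {t : Fin n} (h : a t ≠ 0) (i : Fin n) :
    (a - Finsupp.single t 1 + Finsupp.single i 1).degree = a.degree := by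
  have := map_move (Finsupp.degree (R := ℕ)) h i
  rw [Finsupp.degree_single, Finsupp.degree_single] at this
  omega

theorem weight_move_lt {a : Fin n →₀ ℕ} {t i : Fin n} (h : a t ≠ 0) (hi : i < t) :
    Finsupp.weight (fun l : Fin n => (l : ℕ)) (a - Finsupp.single t 1 + Finsupp.single i 1) <
      Finsupp.weight (fun l : Fin n => (l : ℕ)) a := by
  have := map_move (Finsupp.weight (fun l : Fin n => (l : ℕ))) h i
  simp only [Finsupp.weight_single, one_smul] at this
  have := Fin.lt_def.1 hi
  omega

theorem eq_of_le_of_degree_le {a b : Fin n →₀ ℕ} (h : a ≤ b) (hd : b.degree ≤ a.degree) :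
    a = b := by
  have h1 : b = a + (b - a) := (add_tsub_cancel_of_le h).symm
  have h2 : b.degree = a.degree + (b - a).degree := by
    conv_lhs => rw [h1, map_add]
  have h3 : b - a = 0 := (Finsupp.degree_eq_zero_iff _).1 (by omega)
  rw [h3, add_zero] at h1
  exact h1.symm

theorem exists_isGreatest_support {a : Fin n →₀ ℕ} (ha : a ≠ 0) :
    ∃ t, IsGreatest {l | a l ≠ 0} t := by
  obtain ⟨t, ht⟩ := Finset.exists_max_image a.support id (Finsupp.support_nonempty_iff.2 ha)
  exact ⟨t, Finsupp.mem_support_iff.1 ht.1, fun l hl => ht.2 l (Finsupp.mem_support_iff.2 hl)⟩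

/-- Either `b` has a smaller exponent at `t` and already divides `a / x_t`, or it has a smaller
exponent at some `i < t`, and then `x_i (b / x_t)` divides `a / x_t`. -/
theorem IsStableSet.sub_single_mem {A : Set (Fin n →₀ ℕ)} (hA : IsStableSet A)
    {a b : Fin n →₀ ℕ} (hb : b ∈ A) (hba : b ≤ a) (hne : b ≠ a) {t : Fin n}
    (ht : IsGreatest {l | a l ≠ 0} t) : a - Finsupp.single t 1 ∈ A := by
  by_cases hbt : b t < a t
  · refine hA.1 (fun l => ?_) hb
    have := hba l
    rw [Finsupp.tsub_apply, Finsupp.single_apply]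
    split_ifs <;> subst_vars <;> omega
  · have hbt' : b t = a t := le_antisymm (hba t) (not_lt.1 hbt)
    have hle : ∀ l, b l ≠ 0 → l ≤ t := fun l hl => ht.2 fun h => hl (Nat.le_zero.1 (h ▸ hba l))
    have htb : IsGreatest {l | b l ≠ 0} t := ⟨fun h => ht.1 (hbt'.symm.trans h), hle⟩
    obtain ⟨i, hi⟩ : ∃ i, b i ≠ a i := by
      by_contra! h
      exact hne (Finsupp.ext h)
    have hilt : b i < a i := lt_of_le_of_ne (hba i) hi
    have hit : i < t :=
      lt_of_le_of_ne (ht.2 (Nat.ne_zero_of_lt hilt)) fun h => hi (h ▸ hbt')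
    refine hA.1 (fun l => ?_) (hA.2 b hb t htb i hit)
    have := hba l
    rw [move_apply, Finsupp.tsub_apply, Finsupp.single_apply]
    have := hit.ne
    split_ifs <;> subst_vars <;> first | contradiction | omega

/-- The exponents divisible by an element of `G`. -/
def upset (G : Set (Fin n →₀ ℕ)) : Set (Fin n →₀ ℕ) := {a | ∃ g ∈ G, g ≤ a}

theorem isUpperSet_upset (G : Set (Fin n →₀ ℕ)) : IsUpperSet (upset G) :=
  fun _ _ hab ⟨g, hg, hga⟩ => ⟨g, hg, hga.trans hab⟩

/-- If `u` is the last element of maximal degree of the minimal generating set `G` of a stable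
ideal, then `G \ {u}` generates a stable ideal. -/
theorem IsStableSet.erase {G : Finset (Fin n →₀ ℕ)} (hG : IsStableSet (upset (G : Set (Fin n →₀ ℕ))))
    {u : Fin n →₀ ℕ} (hdeg : ∀ g ∈ G, g.degree ≤ u.degree)
    (hw : ∀ g ∈ G, g.degree = u.degree → Finsupp.weight (fun l : Fin n => (l : ℕ)) g ≤
      Finsupp.weight (fun l : Fin n => (l : ℕ)) u) :
    IsStableSet (upset (G.erase u : Set (Fin n →₀ ℕ))) := by
  refine ⟨isUpperSet_upset _, ?_⟩
  rintro a ⟨g, hg, hga⟩ t ht i hit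
  have hgG : g ∈ G := Finset.mem_of_mem_erase hg
  by_cases hgt : g t < a t
  · refine ⟨g, hg, fun l => ?_⟩
    rw [move_apply]
    have := hga l
    split_ifs <;> subst_vars <;> omega
  · have hgt' : g t ≠ 0 := by
      have : a t ≠ 0 := ht.1
      omega
    have htg : IsGreatest {l | g l ≠ 0} t := by
      refine ⟨hgt', fun l hl => ht.2 ?_⟩
      have := hga l
      have hl : g l ≠ 0 := hl
      change a l ≠ 0
      omega
    obtain ⟨h, hh, hhg⟩ := hG.2 g ⟨g, hgG, le_rfl⟩ t htg i hit
    refine ⟨h, Finset.mem_erase.2 ⟨?_, hh⟩, hhg.trans ?_⟩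
    -- If the generator found were `u`, maximality of its degree would make it equal to `x_i (g /
    -- x_t)`. Then `g` would have the same degree and strictly larger weight, against `hw`.
    · rintro rfl
      have h1 := degree_move hgt' i
      have h2 := hdeg g hgG
      have h3 := eq_of_le_of_degree_le hhg (by omega)
      have h4 := weight_move_lt hgt' hit
      rw [← h3] at h1 h4
      have h5 := hw g hgG h1.symm
      omega
    · intro l
      rw [move_apply, move_apply]
      have := hga l
      split_ifs <;> omega

/-- The colon ideal `(G \ {u}) : u` is generated by the variables before the last one in `u`. -/
theorem add_mem_upset_erase_iff {G : Finset (Fin n →₀ ℕ)} (hanti : IsAntichain (· ≤ ·) (G : Set (Fin n →₀ ℕ)))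
    (hG : IsStableSet (upset (G : Set (Fin n →₀ ℕ)))) {u : Fin n →₀ ℕ} (hu : u ∈ G)
    (hG' : IsStableSet (upset (G.erase u : Set (Fin n →₀ ℕ)))) (c : Fin n →₀ ℕ) :
    c + u ∈ upset (G.erase u : Set (Fin n →₀ ℕ)) ↔
      ∃ i, (∃ t, IsGreatest {l | u l ≠ 0} t ∧ i < t) ∧ c i ≠ 0 := by
  constructor
  · intro hc
    by_contra! hσ
    -- Strip the last variable of `c` until `c = 0`, where a generator other than `u` would divide
    -- `u`. As `c` has no variable before the last one of `u`, its last variable is also the last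
    -- one of `c + u`, so `sub_single_mem` applies.
    induction hd : c.degree using Nat.strong_induction_on generalizing c with
    | _ d ih =>
    obtain ⟨g, hg, hgc⟩ := hc
    have hgG := Finset.mem_erase.1 (Finset.mem_coe.1 hg)
    rcases eq_or_ne c 0 with rfl | hc0
    · rw [zero_add] at hgc
      exact hgG.1 (hanti.eq hgG.2 hu hgc)
    obtain ⟨t, ht⟩ := exists_isGreatest_support hc0
    have ht0 : c t ≠ 0 := ht.1
    have hut : ∀ l, u l ≠ 0 → l ≤ t := by
      intro l hl
      by_contra! htl
      obtain ⟨s, hs⟩ := exists_isGreatest_support (a := u) (by rintro rfl; exact hl rfl)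
      exact ht0 (hσ t ⟨s, hs, htl.trans_le (hs.2 hl)⟩)
    have hcd : (c - Finsupp.single t 1).degree < d := by
      have : (c - Finsupp.single t 1 + Finsupp.single t 1).degree = c.degree := by
        rw [tsub_add_cancel_of_le (single_one_le ht0)]
      rw [map_add, Finsupp.degree_single] at this
      omega
    have hcσ : ∀ i, (∃ s, IsGreatest {l | u l ≠ 0} s ∧ i < s) →
        (c - Finsupp.single t 1 : Fin n →₀ ℕ) i = 0 := by
      intro i hi
      rw [Finsupp.tsub_apply, hσ i hi, Nat.zero_sub]
    refine ih _ hcd (c - Finsupp.single t 1) ?_ hcσ rfl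
    have hcu : IsGreatest {l | (c + u) l ≠ 0} t := by
      refine ⟨fun h => ht0 (Nat.eq_zero_of_add_eq_zero_right h), fun l hl => ?_⟩
      by_cases h : c l = 0
      · refine hut l fun h' => hl ?_
        rw [Finsupp.add_apply, h, h']
      · exact ht.2 h
    have hne : g ≠ c + u := by
      rintro rfl
      exact hgG.1 (hanti.eq hu hgG.2 le_add_self).symm
    have := hG'.sub_single_mem ⟨g, hg, le_rfl⟩ hgc hne hcu
    rwa [tsub_add_eq_add_tsub (single_one_le ht0)]
  · rintro ⟨i, ⟨t, ht, hit⟩, hci⟩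
    obtain ⟨h, hh, hhu⟩ := hG.2 u ⟨u, hu, le_rfl⟩ t ht i hit
    refine ⟨h, Finset.mem_erase.2 ⟨?_, hh⟩, hhu.trans ?_⟩
    · rintro rfl
      have h1 := hhu t
      have h2 : h t ≠ 0 := ht.1
      rw [move_apply, if_pos rfl, if_neg hit.ne] at h1
      omega
    · intro l
      rw [move_apply, Finsupp.add_apply]
      split_ifs <;> subst_vars <;> omega

end Exponents

/-! ### Regularity of stable monomial ideals. -/

section MonomialIdeals

variable {k : Type u} [Field k] {n : ℕ}

local notation "S" => MvPolynomial (Fin n) k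

/-- The ideal generated by the monomials with exponents in `A`. -/
noncomputable def monoIdeal (k : Type u) [Field k] {n : ℕ} (A : Set (Fin n →₀ ℕ)) :
    Ideal (MvPolynomial (Fin n) k) :=
  Ideal.span ((fun a => monomial a (1 : k)) '' A)

theorem mem_monoIdeal {A : Set (Fin n →₀ ℕ)} {f : S} :
    f ∈ monoIdeal k A ↔ ∀ a ∈ f.support, a ∈ upset A :=
  mem_ideal_span_monomial_image

theorem monomial_mem_monoIdeal {A : Set (Fin n →₀ ℕ)} {a : Fin n →₀ ℕ} :
    monomial a (1 : k) ∈ monoIdeal k A ↔ a ∈ upset A := by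
  classical
  rw [mem_monoIdeal, support_monomial, if_neg one_ne_zero]
  simp

theorem upset_eq_self {A : Set (Fin n →₀ ℕ)} (hA : IsUpperSet A) : upset A = A :=
  Set.Subset.antisymm (fun _ ⟨_, hg, hga⟩ => hA hga hg) fun a ha => ⟨a, ha, le_rfl⟩

theorem monoIdeal_congr {A B : Set (Fin n →₀ ℕ)} (h : upset A = upset B) :
    monoIdeal k A = monoIdeal k B := by
  ext f
  rw [mem_monoIdeal, mem_monoIdeal, h]

theorem isHomogeneousIdeal_monoIdeal (A : Set (Fin n →₀ ℕ)) :
    IsHomogeneousIdeal (monoIdeal k A) := fun j f hf => by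
  rw [mem_monoIdeal] at hf ⊢
  exact fun a ha => hf a (support_component_subset j f ha)

theorem mul_monomial_mem_monoIdeal {A : Set (Fin n →₀ ℕ)} {f : S} {u : Fin n →₀ ℕ} :
    f * monomial u 1 ∈ monoIdeal k A ↔ ∀ a ∈ f.support, a + u ∈ upset A := by
  rw [mem_monoIdeal]
  constructor
  · intro h a ha
    refine h _ ?_
    rw [mem_support_iff, coeff_mul_monomial, mul_one]
    exact mem_support_iff.1 ha
  · intro h a ha
    rw [mem_support_iff, coeff_mul_monomial'] at ha
    split_ifs at ha with hua
    · rw [← tsub_add_cancel_of_le hua]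
      refine h _ ?_
      rw [mul_one] at ha
      exact mem_support_iff.2 ha
    · exact absurd rfl ha

theorem RegBound.mono {i : ℕ} {M : Type u} [AddCommGroup M] [Module (MvPolynomial (Fin n) k) M]
    {ℳ : ℤ → AddSubgroup M} {r s : ℤ} (hrs : r ≤ s) (h : RegBound k n i M ℳ r) :
    RegBound k n i M ℳ s := by
  induction i generalizing M r s with
  | zero => trivial
  | succ i ih =>
    obtain ⟨ι, deg, ε, hd, hε, hs, hk⟩ := h
    exact ⟨ι, deg, ε, fun b => (hd b).trans hrs, hε, hs, ih (by omega) hk⟩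

theorem regBound_bot (i : ℕ) (e r : ℤ) :
    RegBound k n i (⊥ : Ideal S) (idealShift ⊥ e) r :=
  regBound_of_subsingleton i r

theorem monoIdeal_insert (A : Set (Fin n →₀ ℕ)) (u : Fin n →₀ ℕ) :
    monoIdeal k (insert u A) = monoIdeal k A ⊔ Ideal.span {monomial u 1} := by
  rw [monoIdeal, Set.image_insert_eq, Ideal.span_insert, sup_comm]
  rfl

theorem monoIdeal_empty : monoIdeal k (∅ : Set (Fin n →₀ ℕ)) = ⊥ := by
  rw [monoIdeal, Set.image_empty, Ideal.span_empty]

theorem mem_upset_single_image {σ : Set (Fin n)} {a : Fin n →₀ ℕ} :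
    a ∈ upset ((fun i => Finsupp.single i 1) '' σ) ↔ ∃ i ∈ σ, a i ≠ 0 := by
  constructor
  · rintro ⟨_, ⟨i, hi, rfl⟩, hia⟩
    rw [Finsupp.single_le_iff] at hia
    exact ⟨i, hi, by omega⟩
  · rintro ⟨i, hi, hai⟩
    exact ⟨_, ⟨i, hi, rfl⟩, single_one_le hai⟩

/-- Ideals generated by variables have linear resolutions. -/
theorem regBound_variables (σ : Finset (Fin n)) (i : ℕ) (e : ℤ) :
    RegBound k n i (monoIdeal k ((fun i => Finsupp.single i 1) '' (σ : Set (Fin n))))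
      (idealShift _ e) (e + 1) := by
  classical
  induction σ using Finset.induction_on generalizing i e with
  | empty =>
    rw [Finset.coe_empty, Set.image_empty, monoIdeal_empty]
    exact regBound_bot _ _ _
  | insert x σ hx ih =>
    cases i with
    | zero => trivial
    | succ i =>
      refine RegBound.sup_span_singleton (b := 1) (isHomogeneousIdeal_monoIdeal _)
        (isHomogeneousIdeal_monoIdeal ((fun i => Finsupp.single i 1) '' (σ : Set (Fin n))))
        (u := monomial (Finsupp.single x 1) 1) ?_ ?_ ?_ le_rfl (ih (i + 1) e) (ih i (e + 1))
      · simpa using inDegree_monomial (k := k) (Finsupp.single x 1) 1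
      · rw [← monoIdeal_insert, Finset.coe_insert, Set.image_insert_eq]
      · intro f
        rw [mul_monomial_mem_monoIdeal, mem_monoIdeal]
        refine forall₂_congr fun a _ => ?_
        rw [mem_upset_single_image, mem_upset_single_image]
        refine exists_congr fun l => and_congr_right fun hl => ?_
        -- The new variable is not in `σ`, so multiplying by it does not affect divisibility by
        -- variables in `σ`: the colon ideal is the old ideal itself.
        have : x ≠ l := by rintro rfl; exact hx hl
        rw [Finsupp.add_apply, Finsupp.single_eq_of_ne' this, add_zero]

/-- A stable ideal generated in degrees at most `d` has regularity at most `d`. -/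
theorem regBound_of_isStableSet {d : ℕ} (G : Finset (Fin n →₀ ℕ))
    (hanti : IsAntichain (· ≤ ·) (G : Set (Fin n →₀ ℕ))) (hG : IsStableSet (upset (G : Set (Fin n →₀ ℕ))))
    (hd : ∀ g ∈ G, g.degree ≤ d) (i : ℕ) :
    RegBound k n i (monoIdeal k (G : Set (Fin n →₀ ℕ))) (idealShift _ 0) d := by
  classical
  induction hc : G.card generalizing G with
  | zero =>
    rw [Finset.card_eq_zero.1 hc, Finset.coe_empty, monoIdeal_empty]
    exact regBound_bot _ _ _
  | succ N ih =>
    cases i with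
    | zero => trivial
    | succ i =>
      -- The lexicographic maximum of (degree, weight) provides both conditions of
      -- `IsStableSet.erase`.
      obtain ⟨u, hu, humax⟩ := Finset.exists_max_image G (fun a : Fin n →₀ ℕ =>
        toLex (a.degree, Finsupp.weight (fun l : Fin n => (l : ℕ)) a))
        (Finset.card_pos.1 (by omega))
      simp only [Prod.Lex.toLex_le_toLex] at humax
      have hG' := hG.erase (u := u) (fun g hg => by have := humax g hg; omega)
        (fun g hg hgd => by have := humax g hg; omega)
      let σ : Finset (Fin n) := {i | ∃ t, IsGreatest {l | u l ≠ 0} t ∧ i < t}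
      refine RegBound.sup_span_singleton (b := u.degree) (isHomogeneousIdeal_monoIdeal _)
        (isHomogeneousIdeal_monoIdeal (G.erase u : Set (Fin n →₀ ℕ)))
        (inDegree_monomial u 1) ?_ ?_ ?_
        (ih (G.erase u) (hanti.subset (Finset.coe_subset.2 (G.erase_subset u))) hG'
          (fun g hg => hd g (Finset.mem_of_mem_erase hg))
          (by rw [Finset.card_erase_of_mem hu, hc, Nat.add_sub_cancel]))
        ((regBound_variables σ i (0 + u.degree)).mono ?_)
      · rw [← monoIdeal_insert, ← Finset.coe_insert, Finset.insert_erase hu]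
      · intro f
        rw [mul_monomial_mem_monoIdeal, mem_monoIdeal]
        refine forall₂_congr fun a _ => ?_
        rw [mem_upset_single_image, add_mem_upset_erase_iff hanti hG hu hG']
        simp [σ]
      · have := hd u hu
        omega
      · have := hd u hu
        omega

/-- The ideal with exponent set `A` is generated in degrees at most `d`. -/
def GeneratedInDegreeLE (A : Set (Fin n →₀ ℕ)) (d : ℕ) : Prop :=
  ∀ a ∈ A, ∃ b ∈ A, b ≤ a ∧ b.degree ≤ d

/-- Dickson's lemma: antichains of exponents are finite, and every exponent of `A` lies above a
minimal one. -/
theorem exists_finset_minimal (A : Set (Fin n →₀ ℕ)) : ∃ G : Finset (Fin n →₀ ℕ),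
    IsAntichain (· ≤ ·) (G : Set (Fin n →₀ ℕ)) ∧ (∀ a, a ∈ G ↔ Minimal (· ∈ A) a) ∧
      ∀ a ∈ A, ∃ g ∈ G, g ≤ a := by
  have hanti := setOfPred_minimal_antichain (α := Fin n →₀ ℕ) (· ∈ A)
  have hfin : {a | Minimal (· ∈ A) a}.Finite := WellQuasiOrderedLE.finite_of_isAntichain hanti
  refine ⟨hfin.toFinset, by rwa [hfin.coe_toFinset], fun a => hfin.mem_toFinset, fun a ha => ?_⟩
  obtain ⟨m, hma, hm⟩ := exists_minimal_le_of_wellFoundedLT (· ∈ A) a ha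
  exact ⟨m, hfin.mem_toFinset.2 hm, hma⟩

theorem exists_generatedInDegreeLE (A : Set (Fin n →₀ ℕ)) : ∃ d, GeneratedInDegreeLE A d := by
  obtain ⟨G, -, hG, hGA⟩ := exists_finset_minimal A
  refine ⟨G.sup Finsupp.degree, fun a ha => ?_⟩
  obtain ⟨g, hg, hga⟩ := hGA a ha
  exact ⟨g, ((hG g).1 hg).1, hga, Finset.le_sup (f := Finsupp.degree) hg⟩

/-- In a product `f y` with `y` in the ideal, minimality of `b` lets only the constant term of `f`
contribute to the coefficient at `b`. So a minimal generator is not in `(x₁, …, xₙ) I`. -/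
theorem coeff_eq_zero_of_mem_irrelevant_smul {A : Set (Fin n →₀ ℕ)} {b : Fin n →₀ ℕ}
    (hb : ∀ a ∈ A, a ≤ b → a = b) (x : monoIdeal k A)
    (hx : x ∈ irrelevant k n • (⊤ : Submodule S (monoIdeal k A))) : coeff b (x : S) = 0 := by
  classical
  refine Submodule.smul_induction_on hx ?_ ?_
  · intro f hf y _
    rw [Submodule.coe_smul, smul_eq_mul, coeff_mul]
    refine Finset.sum_eq_zero fun pq hpq => ?_
    rw [Finset.HasAntidiagonal.mem_antidiagonal] at hpq
    by_contra h
    obtain ⟨a, ha, hay⟩ := mem_monoIdeal.1 y.2 pq.2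
      (mem_support_iff.2 (right_ne_zero_of_mul h))
    have hab := hb a ha (hay.trans (hpq ▸ le_add_self))
    have h2 : pq.2 = b := le_antisymm (hpq ▸ le_add_self) (hab ▸ hay)
    have h1 : pq.1 = 0 := by
      rw [h2] at hpq
      exact add_eq_right.1 hpq
    refine left_ne_zero_of_mul h ?_
    rw [h1]
    exact hf
  · intro x y hx hy
    rw [Submodule.coe_add, coeff_add, hx, hy, add_zero]

theorem hasRegularity_monoIdeal {A : Set (Fin n →₀ ℕ)} (hA : IsStableSet A) (hne : A.Nonempty)
    {d : ℕ} (hd : GeneratedInDegreeLE A d)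
    (hmin : ∀ m, GeneratedInDegreeLE A m → d ≤ m) :
    HasRegularity k n (idealPart (monoIdeal k A)) d := by
  obtain ⟨G, hanti, hG, hGA⟩ := exists_finset_minimal A
  have hup : upset A = upset (G : Set (Fin n →₀ ℕ)) := by
    rw [upset_eq_self hA.1]
    exact Set.Subset.antisymm hGA fun a ⟨g, hg, hga⟩ => hA.1 hga ((hG g).1 hg).1
  have hGd : ∀ g ∈ G, g.degree ≤ d := by
    intro g hg
    obtain ⟨b, hb, hbg, hbd⟩ := hd g ((hG g).1 hg).1
    rwa [← ((hG g).1 hg).eq_of_le hb hbg]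
  -- Since `d` is the least generating degree, some minimal generator attains it; this one witnesses
  -- the nonvanishing of `β_{0, d}`.
  obtain ⟨u, hu, hud⟩ : ∃ u ∈ G, u.degree = d := by
    obtain ⟨a, ha⟩ := hne
    obtain ⟨g, hg, -⟩ := hGA a ha
    obtain ⟨u, hu, humax⟩ := Finset.exists_max_image G Finsupp.degree ⟨g, hg⟩
    refine ⟨u, hu, le_antisymm (hGd u hu) (hmin _ fun a ha => ?_)⟩
    obtain ⟨g, hg, hga⟩ := hGA a ha
    exact ⟨g, ((hG g).1 hg).1, hga, humax g hg⟩
  have hreg : ∀ i, RegBound k n i (monoIdeal k A) (idealPart (monoIdeal k A)) d := by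
    intro i
    rw [monoIdeal_congr hup, ← idealShift_zero]
    refine regBound_of_isStableSet G hanti ?_ hGd i
    rwa [← hup, upset_eq_self hA.1]
  have hgr : IsGraded k n (idealPart (monoIdeal k A)) := by
    rw [← idealShift_zero]
    exact (isHomogeneousIdeal_monoIdeal A).isGraded 0
  have huA := (hG u).1 hu
  refine hasRegularity_of_regBound hgr hreg
    (m := ⟨monomial u 1, monomial_mem_monoIdeal.2 ⟨u, huA.1, le_rfl⟩⟩) ?_ fun hmem => ?_
  · rw [← hud]
    exact inDegree_monomial u 1
  · have := coeff_eq_zero_of_mem_irrelevant_smul (fun a ha hau => le_antisymm hau (huA.2 ha hau)) _ hmem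
    rw [coeff_monomial, if_pos rfl] at this
    exact one_ne_zero this

end MonomialIdeals

/-! ### Powers and integral closure on the level of exponents. -/

section ExponentClosure

variable {n : ℕ}

/-- The exponents of the monomials in the `m`-th power of the ideal with exponent set `A`. -/
def powSet (A : Set (Fin n →₀ ℕ)) : ℕ → Set (Fin n →₀ ℕ)
  | 0 => Set.univ
  | m + 1 => {a | ∃ b ∈ A, ∃ c ∈ powSet A m, b + c = a}

/-- The exponents of the monomials in the integral closure of the ideal with exponent set `A`. -/
def closureSet (A : Set (Fin n →₀ ℕ)) : Set (Fin n →₀ ℕ) :=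
  {a | ∃ m, 1 ≤ m ∧ m • a ∈ powSet A m}

variable {A : Set (Fin n →₀ ℕ)}

theorem isUpperSet_powSet (hA : IsUpperSet A) (m : ℕ) : IsUpperSet (powSet A m) := by
  cases m with
  | zero => exact isUpperSet_univ
  | succ m =>
    rintro x y hxy ⟨b, hb, c, hc, rfl⟩
    refine ⟨b + (y - (b + c)), hA le_self_add hb, c, hc, ?_⟩
    rw [add_right_comm, add_tsub_cancel_of_le hxy]

/-- The last variable of a product is the last variable of one of the factors, and the exchange can
be made in that factor. -/
theorem IsStableSet.powSet (hA : IsStableSet A) (m : ℕ) : IsStableSet (powSet A m) := by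
  induction m with
  | zero => exact ⟨isUpperSet_univ, fun _ _ _ _ _ _ => trivial⟩
  | succ m ih =>
    refine ⟨isUpperSet_powSet hA.1 _, ?_⟩
    rintro _ ⟨b, hb, c, hc, rfl⟩ t ht i hit
    have hbt : ∀ l, b l ≠ 0 → l ≤ t := fun l hl =>
      ht.2 fun h => hl (Nat.eq_zero_of_add_eq_zero_right h)
    have hct : ∀ l, c l ≠ 0 → l ≤ t := fun l hl =>
      ht.2 fun h => hl (Nat.eq_zero_of_add_eq_zero_left h)
    by_cases hbt0 : b t = 0
    · have hct0 : c t ≠ 0 := fun h => ht.1 (by rw [Finsupp.add_apply, hbt0, h])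
      refine ⟨b, hb, _, ih.2 c hc t ⟨hct0, hct⟩ i hit, ?_⟩
      rw [← add_assoc, add_tsub_assoc_of_le (single_one_le hct0)]
    · refine ⟨_, hA.2 b hb t ⟨hbt0, hbt⟩ i hit, c, hc, ?_⟩
      rw [add_right_comm, tsub_add_eq_add_tsub (single_one_le hbt0)]

theorem GeneratedInDegreeLE.powSet {d : ℕ} (hd : GeneratedInDegreeLE A d) (m : ℕ) :
    GeneratedInDegreeLE (powSet A m) (m * d) := by
  induction m with
  | zero => exact fun a _ => ⟨0, trivial, zero_le, by simp⟩
  | succ m ih =>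
    rintro _ ⟨b, hb, c, hc, rfl⟩
    obtain ⟨b', hb', hbb, hbd⟩ := hd b hb
    obtain ⟨c', hc', hcc, hcd⟩ := ih c hc
    refine ⟨b' + c', ⟨b', hb', c', hc', rfl⟩, add_le_add hbb hcc, ?_⟩
    rw [map_add, Nat.succ_mul]
    omega

theorem IsStableSet.iterate_move (hA : IsStableSet A) {a : Fin n →₀ ℕ} (ha : a ∈ A) {t i : Fin n}
    (ht : ∀ l, a l ≠ 0 → l ≤ t) (hit : i < t) {p : ℕ} (hp : p ≤ a t) :
    a - Finsupp.single t p + Finsupp.single i p ∈ A := by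
  induction p with
  | zero => simpa using ha
  | succ p ih =>
    have e : ∀ (q : ℕ) (l : Fin n),
        (a - Finsupp.single t q + Finsupp.single i q : Fin n →₀ ℕ) l =
          a l - (if t = l then q else 0) + (if i = l then q else 0) := by
      intro q l
      rw [Finsupp.add_apply, Finsupp.tsub_apply, Finsupp.single_apply, Finsupp.single_apply]
    convert hA.2 _ (ih (by omega)) t ⟨?_, fun l hl => ?_⟩ i hit using 1
    · ext l
      rw [e, move_apply, e]
      have := hit.ne
      split_ifs <;> subst_vars <;> first | contradiction | omega
    · change (a - Finsupp.single t p + Finsupp.single i p : Fin n →₀ ℕ) t ≠ 0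
      rw [e, if_pos rfl, if_neg hit.ne]
      omega
    · have hl : (a - Finsupp.single t p + Finsupp.single i p : Fin n →₀ ℕ) l ≠ 0 := hl
      rw [e] at hl
      by_cases hil : i = l
      · exact (hil ▸ hit).le
      · rw [if_neg hil] at hl
        exact ht l (by omega)

theorem degree_sub_single {a : Fin n →₀ ℕ} {t : Fin n} {p : ℕ} (hp : p ≤ a t) :
    (a - Finsupp.single t p).degree + p = a.degree := by
  conv_rhs => rw [← tsub_add_cancel_of_le (Finsupp.single_le_iff.2 hp)]
  rw [map_add, Finsupp.degree_single]

/-- While the degree exceeds `d`, the current exponent is not a minimal one, so `sub_single_mem`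
deletes one more copy of `x_t`. The bound on `p` keeps `t` the last index until then. -/
theorem IsStableSet.iterate_sub (hA : IsStableSet A) {d : ℕ} (hd : GeneratedInDegreeLE A d)
    {a : Fin n →₀ ℕ} (ha : a ∈ A) {t : Fin n} (ht : ∀ l, a l ≠ 0 → l ≤ t) {p : ℕ} (hp : p ≤ a t)
    (hpd : d + p ≤ a.degree) : a - Finsupp.single t p ∈ A := by
  induction p with
  | zero => simpa using ha
  | succ p ih =>
    have hmem := ih (by omega) (by omega)
    have e : ∀ (q : ℕ) (l : Fin n),
        (a - Finsupp.single t q : Fin n →₀ ℕ) l = a l - (if t = l then q else 0) := by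
      intro q l
      rw [Finsupp.tsub_apply, Finsupp.single_apply]
    obtain ⟨b, hb, hba, hbd⟩ := hd _ hmem
    have hdeg := degree_sub_single (a := a) (t := t) (p := p) (by omega)
    rw [Finsupp.single_add, ← tsub_tsub]
    refine hA.sub_single_mem hb hba (by rintro rfl; omega) ⟨?_, fun l hl => ?_⟩
    · change (a - Finsupp.single t p : Fin n →₀ ℕ) t ≠ 0
      rw [e, if_pos rfl]
      omega
    · have hl : (a - Finsupp.single t p : Fin n →₀ ℕ) l ≠ 0 := hl
      rw [e] at hl
      exact ht l (by omega)

theorem smul_apply_ne_zero {m : ℕ} {a : Fin n →₀ ℕ} {l : Fin n} (h : (m • a) l ≠ 0) :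
    a l ≠ 0 := by
  rw [Finsupp.smul_apply] at h
  exact right_ne_zero_of_smul h

theorem isUpperSet_closureSet (hA : IsUpperSet A) : IsUpperSet (closureSet A) :=
  fun _ _ hab ⟨m, hm, h⟩ => ⟨m, hm, isUpperSet_powSet hA m (nsmul_le_nsmul_right hab m) h⟩

theorem IsStableSet.closureSet (hA : IsStableSet A) : IsStableSet (closureSet A) := by
  refine ⟨isUpperSet_closureSet hA.1, ?_⟩
  rintro a ⟨m, hm, h⟩ t ht i hit
  refine ⟨m, hm, ?_⟩
  have hat : 1 ≤ a t := Nat.one_le_iff_ne_zero.2 ht.1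
  -- One exchange in `a` is `m` exchanges in `m • a`, performed inside the stable set of exponents
  -- of `I ^ m`.
  convert (hA.powSet m).iterate_move h (fun l hl => ht.2 (smul_apply_ne_zero hl)) hit
    (p := m) (by rw [Finsupp.smul_apply]; exact Nat.le_mul_of_pos_right m hat) using 1
  ext l
  simp only [Finsupp.smul_apply, Finsupp.add_apply, Finsupp.tsub_apply, Finsupp.single_apply,
    smul_eq_mul, mul_add, Nat.mul_sub, mul_ite, mul_one, mul_zero]

theorem GeneratedInDegreeLE.closureSet (hA : IsStableSet A) {d : ℕ}
    (hd : GeneratedInDegreeLE A d) : GeneratedInDegreeLE (closureSet A) d := by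
  intro a ha
  induction hN : a.degree using Nat.strong_induction_on generalizing a with
  | _ N ih =>
  by_cases hNd : N ≤ d
  · exact ⟨a, ha, le_rfl, hN ▸ hNd⟩
  obtain ⟨t, ht⟩ := exists_isGreatest_support (a := a) (by rintro rfl; simp at hN; omega)
  have hat : 1 ≤ a t := Nat.one_le_iff_ne_zero.2 ht.1
  have hmem : a - Finsupp.single t 1 ∈ StableReg.closureSet A := by
    obtain ⟨m, hm, h⟩ := ha
    refine ⟨m, hm, ?_⟩
    -- As `a` has degree at least `d + 1`, `m • a` exceeds the generating degree `m * d` by at least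
    -- `m`: just enough to delete `m` copies of `x_t`.
    convert (hA.powSet m).iterate_sub (hd.powSet m) h (fun l hl => ht.2 (smul_apply_ne_zero hl))
      (p := m) (by rw [Finsupp.smul_apply]; exact Nat.le_mul_of_pos_right m hat) ?_ using 1
    · ext l
      simp only [Finsupp.smul_apply, Finsupp.tsub_apply, Finsupp.single_apply,
        smul_eq_mul, Nat.mul_sub, mul_ite, mul_one, mul_zero]
    · rw [map_nsmul, smul_eq_mul, ← Nat.mul_succ]
      exact Nat.mul_le_mul_left m (by omega)
  have := degree_sub_single hat
  obtain ⟨b, hb, hba, hbd⟩ := ih _ (by omega) _ hmem rfl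
  exact ⟨b, hb, hba.trans tsub_le_self, hbd⟩

end ExponentClosure

/-! ### The integral closure of a monomial ideal is monomial. -/

section IntegralClosureOfMonomialIdeals

variable {k : Type u} [Field k] {n : ℕ} {A : Set (Fin n →₀ ℕ)}

local notation "S" => MvPolynomial (Fin n) k

theorem monoIdeal_pow (A : Set (Fin n →₀ ℕ)) (m : ℕ) :
    monoIdeal k A ^ m = monoIdeal k (powSet A m) := by
  induction m with
  | zero =>
    rw [pow_zero, Ideal.one_eq_top, eq_comm, Ideal.eq_top_iff_one]
    exact monomial_mem_monoIdeal.2 ⟨0, trivial, le_rfl⟩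
  | succ m ih =>
    rw [pow_succ', ih, monoIdeal, monoIdeal, monoIdeal, Ideal.span_mul_span']
    congr 1
    ext f
    rw [Set.mem_mul]
    constructor
    · rintro ⟨_, ⟨b, hb, rfl⟩, _, ⟨c, hc, rfl⟩, rfl⟩
      exact ⟨b + c, ⟨b, hb, c, hc, rfl⟩, by simp⟩
    · rintro ⟨_, ⟨b, hb, c, hc, rfl⟩, rfl⟩
      exact ⟨_, ⟨b, hb, rfl⟩, _, ⟨c, hc, rfl⟩, by simp⟩

/-- The coaction `x_i ↦ x_i T_i`, extended to polynomials over `k[x₁, …, xₙ]`. -/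
noncomputable def coaction (k : Type u) [Field k] (n : ℕ) :
    Polynomial (MvPolynomial (Fin n) k) →+*
      MvPolynomial (Fin n) (Polynomial (MvPolynomial (Fin n) k)) :=
  Polynomial.eval₂RingHom
    (eval₂Hom (C.comp (Polynomial.C.comp C)) fun i => C (Polynomial.C (X i)) * X i)
    (C Polynomial.X)

theorem coaction_monomial (i : ℕ) (a : Fin n →₀ ℕ) (c : k) :
    coaction k n (Polynomial.monomial i (monomial a c)) =
      monomial a (Polynomial.monomial i (monomial a c)) := by
  have h : (eval₂Hom ((C (σ := Fin n)).comp (Polynomial.C.comp (C (R := k) (σ := Fin n))))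
      fun i => C (Polynomial.C (X i)) * X i) (monomial a c) =
        monomial a (Polynomial.C (monomial a c)) := by
    rw [coe_eval₂Hom, eval₂_monomial]
    simp only [mul_pow, Finsupp.prod_mul, ← map_pow]
    rw [monomial_eq (s := a) (a := Polynomial.C (monomial a c)), monomial_eq (s := a) (a := c)]
    simp only [Finsupp.prod, map_mul, map_prod, RingHom.comp_apply]
    ring
  rw [coaction, Polynomial.coe_eval₂RingHom, Polynomial.eval₂_monomial, h, ← map_pow, mul_comm,
    C_mul_monomial, mul_comm, Polynomial.C_mul_X_pow_eq_monomial]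

theorem coeff_coaction (p : Polynomial S) (a : Fin n →₀ ℕ) (i : ℕ) :
    (coeff a (coaction k n p)).coeff i = monomial a (coeff a (p.coeff i)) := by
  classical
  induction p using Polynomial.induction_on' with
  | add p q hp hq =>
    rw [map_add, coeff_add, Polynomial.coeff_add, Polynomial.coeff_add, hp, hq, coeff_add, map_add]
  | monomial j f =>
    induction f using MvPolynomial.induction_on' with
    | add f g hf hg =>
      rw [map_add, map_add, coeff_add, Polynomial.coeff_add, Polynomial.coeff_add, hf, hg,
        coeff_add, map_add]
    | monomial b c =>
      rw [coaction_monomial, coeff_monomial, Polynomial.coeff_monomial]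
      by_cases hba : b = a <;> by_cases hji : j = i <;>
        simp [hba, hji, Polynomial.coeff_monomial, coeff_monomial]

-- The multigrading argument: `coaction` separates the terms of `f` as coefficients of different
-- monomials in the `T_i`. Because `I` is monomial, it maps the Rees algebra into polynomials over
-- the Rees algebra, so it preserves integrality; and a polynomial is integral over a polynomial
-- ring iff its coefficients are integral over the base.
attribute [local instance] MvPolynomial.algebraMvPolynomial in
theorem IsIntegralOver.coeff {f : S} (hf : IsIntegralOver (monoIdeal k A) f)
    (a : Fin n →₀ ℕ) : IsIntegralOver (monoIdeal k A) (monomial a (MvPolynomial.coeff a f)) := by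
  rw [isIntegralOver_iff] at hf ⊢
  have hrees : ∀ p ∈ reesAlgebra (monoIdeal k A), ∀ b,
      MvPolynomial.coeff b (coaction k n p) ∈ reesAlgebra (monoIdeal k A) := by
    intro p hp b
    rw [mem_reesAlgebra_iff] at hp ⊢
    intro i
    have hpi := hp i
    rw [monoIdeal_pow, mem_monoIdeal] at hpi
    rw [coeff_coaction, monoIdeal_pow, mem_monoIdeal]
    intro c hc
    have hcb : c = b := Finset.mem_singleton.1 (support_monomial_subset hc)
    subst hcb
    rw [mem_support_iff, coeff_monomial, if_pos rfl] at hc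
    exact hpi c (mem_support_iff.2 hc)
  have hint : IsIntegral (MvPolynomial (Fin n) (reesAlgebra (monoIdeal k A)))
      (coaction k n (Polynomial.monomial 1 f)) := by
    obtain ⟨p, hp, hpf⟩ := hf
    have hlift : p.map ((coaction k n).comp
        (algebraMap (reesAlgebra (monoIdeal k A)) (Polynomial S))) ∈
          Polynomial.lifts (algebraMap (MvPolynomial (Fin n) (reesAlgebra (monoIdeal k A)))
            (MvPolynomial (Fin n) (Polynomial S))) := by
      rw [Polynomial.lifts_iff_coeff_lifts]
      intro i
      rw [Polynomial.coeff_map]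
      refine MvPolynomial.mem_range_map_iff_coeffs_subset.2 fun c hc => ?_
      obtain ⟨b, -, rfl⟩ := mem_coeffs_iff.1 hc
      exact ⟨⟨_, hrees _ (p.coeff i).2 b⟩, rfl⟩
    obtain ⟨q, hq, -, hqm⟩ := Polynomial.lifts_and_natDegree_eq_and_monic hlift (hp.map _)
    refine ⟨q, hqm, ?_⟩
    rw [← Polynomial.eval_map, hq, Polynomial.eval_map, ← Polynomial.hom_eval₂, hpf, map_zero]
  have e : MvPolynomial.coeff a (coaction k n (Polynomial.monomial 1 f)) =
      Polynomial.monomial 1 (monomial a (MvPolynomial.coeff a f)) := by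
    ext1 i
    rw [coeff_coaction, Polynomial.coeff_monomial, Polynomial.coeff_monomial]
    split_ifs <;> simp
  rw [← e]
  exact MvPolynomial.isIntegral_iff_isIntegral_coeff.1 hint a

/-- Compare coefficients at `d • a` in the integral equation. The leading term contributes `c ^ d ≠
0`, so some `b i`, an element of `I ^ i`, must contain the monomial with exponent `i • a`. -/
theorem IsIntegralOver.mem_closureSet (hA : IsUpperSet A) {a : Fin n →₀ ℕ} {c : k} (hc : c ≠ 0)
    (h : IsIntegralOver (monoIdeal k A) (monomial a c)) : a ∈ closureSet A := by
  obtain ⟨d, hd, b, hb, h⟩ := h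
  have h' := congrArg (MvPolynomial.coeff (d • a)) h
  rw [coeff_add, coeff_zero, monomial_pow, coeff_monomial, if_pos rfl, coeff_sum] at h'
  obtain ⟨i, hi, hne⟩ := Finset.exists_ne_zero_of_sum_ne_zero
    (fun h0 => pow_ne_zero d hc (by rw [h0, add_zero] at h'; exact h'))
  obtain ⟨hi1, hid⟩ := Finset.mem_Icc.1 hi
  have hmem := hb i hi
  rw [monoIdeal_pow, mem_monoIdeal, upset_eq_self (isUpperSet_powSet hA i)] at hmem
  refine ⟨i, hi1, hmem _ ?_⟩
  have e : d • a = i • a + (d - i) • a := by rw [← add_smul, Nat.add_sub_cancel' hid]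
  rw [monomial_pow, e, coeff_mul_monomial] at hne
  exact mem_support_iff.2 (left_ne_zero_of_mul hne)

theorem isIntegralOver_of_mem_closureSet {a : Fin n →₀ ℕ} (ha : a ∈ closureSet A) :
    IsIntegralOver (monoIdeal k A) (monomial a (1 : k)) := by
  obtain ⟨m, hm, h⟩ := ha
  -- The equation is `X ^ m - x ^ (m a) = 0`, with all intermediate coefficients zero.
  refine ⟨m, hm, fun i => if i = m then -monomial (m • a) 1 else 0, fun i _ => ?_, ?_⟩
  · dsimp only
    split_ifs with him
    · rw [him, monoIdeal_pow]
      exact neg_mem (monomial_mem_monoIdeal.2 ⟨_, h, le_rfl⟩)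
    · exact zero_mem _
  · rw [Finset.sum_eq_single m (fun i _ him => by simp [him])
      (fun hm' => absurd (Finset.mem_Icc.2 ⟨hm, le_rfl⟩) hm')]
    simp [monomial_pow]

theorem idealClosure_monoIdeal (hA : IsUpperSet A) :
    idealClosure (monoIdeal k A) = monoIdeal k (closureSet A) := by
  ext f
  constructor
  · intro hf
    rw [mem_monoIdeal, upset_eq_self (isUpperSet_closureSet hA)]
    exact fun a ha => (IsIntegralOver.coeff hf a).mem_closureSet hA (mem_support_iff.1 ha)
  · suffices h : monoIdeal k (closureSet A) ≤ idealClosure (monoIdeal k A) from fun hf => h hf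
    refine Ideal.span_le.2 ?_
    rintro _ ⟨a, ha, rfl⟩
    exact isIntegralOver_of_mem_closureSet ha

theorem IsStable.exists_eq_monoIdeal {I : Ideal S} (hI : IsStable I) :
    ∃ A : Set (Fin n →₀ ℕ), IsStableSet A ∧ I = monoIdeal k A := by
  obtain ⟨⟨B, hB⟩, hst⟩ := hI
  have hmem : ∀ a, monomial a (1 : k) ∈ I ↔ a ∈ upset B := fun a => by
    rw [hB]
    exact monomial_mem_monoIdeal
  refine ⟨upset B, ⟨isUpperSet_upset B, fun a ha t ht i hit => ?_⟩, ?_⟩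
  · exact (hmem _).1 (hst a ((hmem a).2 ha) t ht i hit)
  · rw [hB]
    exact monoIdeal_congr (upset_eq_self (isUpperSet_upset B)).symm

end IntegralClosureOfMonomialIdeals

end StableReg

theorem theorem6p5 {k : Type u} [Field k] {n : ℕ} (I : Ideal (MvPolynomial (Fin n) k))
    (hI : StableReg.IsStable I) (hI0 : I ≠ ⊥) :
    ∃ r s : ℤ, StableReg.HasRegularity k n (StableReg.idealPart I) r ∧
      StableReg.HasRegularity k n (StableReg.idealPart (StableReg.idealClosure I)) s ∧ s ≤ r := by
  classical
  obtain ⟨A, hA, rfl⟩ := hI.exists_eq_monoIdeal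
  have hne : A.Nonempty := by
    rw [Set.nonempty_iff_ne_empty]
    rintro rfl
    exact hI0 StableReg.monoIdeal_empty
  have hne' : (StableReg.closureSet A).Nonempty := by
    obtain ⟨a, ha⟩ := hne
    exact ⟨a, 1, le_rfl, a, ha, 0, trivial, by simp⟩
  have hd := StableReg.exists_generatedInDegreeLE A
  have hd' := StableReg.exists_generatedInDegreeLE (StableReg.closureSet A)
  -- Both regularities are least generating degrees, so the inequality says that the closure is
  -- generated in the degrees that suffice for `I`.
  refine ⟨Nat.find hd, Nat.find hd', ?_, ?_, ?_⟩
  · exact StableReg.hasRegularity_monoIdeal hA hne (Nat.find_spec hd)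
      fun m hm => Nat.find_min' hd hm
  · rw [StableReg.idealClosure_monoIdeal hA.1]
    exact StableReg.hasRegularity_monoIdeal hA.closureSet hne' (Nat.find_spec hd')
      fun m hm => Nat.find_min' hd' hm
  · exact_mod_cast Nat.find_min' hd' ((Nat.find_spec hd).closureSet hA)
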